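/- **Model.** Let $\lambda_1,\lambda_2,P_1,T_I,T_E>0$, $\alpha>2$, $d\ge 0$, $\rho\ge 0$, $\sigma\in\mathbb R$ and $0\le\epsilon\le\mathcal E$ with $\mathcal E>0$. Let $\Phi_1=\{(x,t_x)\}$ and $\Phi_2=\{(y,t_y)\}$ be homogeneous Poisson point processes on $\mathbb R^2\times\mathbb R$ (locations and times) with densities $\lambda_1$ and $\lambda_2$ (the primary and the secondary transmitters). Let $h_x$, $g_y$, $g_0\sim\exp(1)$ be the channel coefficients to the origin from the primary transmitters and from the secondary transmitters, and that of the typical secondary link. The receiver of the primary transmitter at $x$ is at $x+e_x$, where the displacements $e_x$ are identically distributed with $\|e_x\|=d$ almost surely. Put $\phi(t,u)=\mathbf 1(u\le t\le u+T_I)$. A secondary transmitter at the origin that awakes at time $0$ harvests the energy $$E_H=\int_0^{T_E}P_1\sum_{(x,t_x)\in\Phi_1}\phi(t,t_x)\,h_x\,(1+\|x\|^\alpha)^{-1}\,dt .$$ Its power is $p=0$ if $E_H<\epsilon$, $p=\mathbb E[E_H]/T_I$ if $\epsilon\le E_H<\mathcal E$, and $p=\mathcal E/T_I$ if $E_H\ge\mathcal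 E$; the average transmit power of the secondary transmitters is $P_2=\mathbb E[p]$. Their transmit probability is $\pi_s=\mathbb P(E_H>\epsilon)\,\pi_\rho$, where $\pi_\rho$ is the probability that no primary receiver whose transmitter is active at the end $T_E$ of the harvesting phase lies within distance $\rho$ of the origin. The process $\Phi_2^a$ of active secondary transmitters is modelled as an independent thinning of $\Phi_2$ with retention probability $\pi_s$, so that its density is $\lambda_2^a=\lambda_2\pi_s$. The processes $\Phi_1$ and $\Phi_2$, all channel coefficients, all displacements and all retention decisions are independent. The typical secondary receiver is at the origin and its transmitter, at distance $d$, is active during $[0,T_I]$ with power $P_2$. The time-averaged interferences are $$\mathrm I_1=\frac1{T_I}\int_0^{T_I}P_1\sum_{(x,t_x)\in\Phi_1}\frac{\phi(t,t_x)h_x}{1+\|x\|^\alpha}\,dt,\qquad \mathrm I_2=\frac1{T_I}\int_0^{T_I}P_2\sum_{(y,t_y)\in\Phi_2^a}\frac{\phi(t,t_y)g_y}{1+\|y\|^\alpha}\,dt,$$ and $$\mathrm{SINR}_2=\frac{P_2\,g_0\,(1+d^\alpha)^{-1}}{\mathrm I_1+\mathrm I_2+\sigma^2}.$$ **Proposition.**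 $P_2>0$, and $\mathrm I_1,\mathrm I_2$ are almost surely finite. For every threshold $\zeta>0$, with $s=\zeta(1+d^\alpha)/P_2$ and $\mathcal L_{\mathrm I_n}(s)=\mathbb E[e^{-s\mathrm I_n}]$, the information coverage probability $p_2^c(\zeta)=\mathbb P(\mathrm{SINR}_2\ge\zeta)$ of the typical secondary receiver is $$p_2^c(\zeta)=\mathcal L_{\mathrm I_1}(s)\,\mathcal L_{\mathrm I_2}(s)\,e^{-\sigma^2 s},$$ and, for $n\in\{1,2\}$, $$\mathcal L_{\mathrm I_n}(s)=\exp\!\left(-2\mu_n\pi^2T_I\csc\!\left(\tfrac{2\pi}{\alpha}\right)\frac{(1+P_ns)^{2/\alpha}(2P_ns-\alpha)+\alpha}{P_ns\,(2+\alpha)}\right),\qquad \mu_1=\lambda_1,\quad \mu_2=\lambda_2^a=\lambda_2\pi_s .$$ -/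

import Mathlib

open MeasureTheory ProbabilityTheory
open scoped ENNReal

noncomputable section

namespace AdHoc

/-- The plane `ℝ²` with its Euclidean norm. -/
abbrev Plane : Type := EuclideanSpace ℝ (Fin 2)

/-- `X 0, X 1, …` enumerates the points of a Poisson point process with intensity measure `μ`:
the number of points in a measurable set `A` of finite `μ`-measure is Poisson with mean `μ A`,
and the numbers of points in pairwise disjoint measurable sets are independent. -/
structure IsPoissonProcess {Ω E : Type*} [MeasurableSpace Ω] [MeasurableSpace E]
    (X : ℕ → Ω → E) (μ : Measure E) (Pr : Measure Ω) : Prop where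
  measurable : ∀ i, Measurable (X i)
  poisson : ∀ A : Set E, MeasurableSet A → μ A < ∞ → ∀ k : ℕ,
    Pr {ω | {i | X i ω ∈ A}.encard = k} =
      ENNReal.ofReal (Real.exp (-(μ A).toReal) * (μ A).toReal ^ k / (k.factorial : ℝ))
  indep : ∀ (n : ℕ) (A : Fin n → Set E), (∀ k, MeasurableSet (A k)) →
    Pairwise (fun k l => Disjoint (A k) (A l)) →
    iIndepFun (fun (k : Fin n) (ω : Ω) => {i | X i ω ∈ A k}.encard) Pr

/-- The deterministic parameters of the two networks. -/
structure Parameters where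
  /-- time-space density of the primary transmitters -/
  lam1 : ℝ
  /-- time-space density of the secondary transmitters -/
  lam2 : ℝ
  /-- transmit power of the primary transmitters -/
  P1 : ℝ
  /-- duration of a transmission -/
  TI : ℝ
  /-- duration of the energy harvesting phase -/
  TE : ℝ
  /-- path-loss exponent -/
  α : ℝ
  /-- distance between a transmitter and its paired receiver -/
  d : ℝ
  /-- square root of the noise variance -/
  σ : ℝ
  /-- energy threshold of the harvesting circuit -/
  ε : ℝ
  /-- saturation level of the harvesting circuit -/
  sat : ℝ
  /-- radius of the guard zone -/
  ρ : ℝ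
  lam1_pos : 0 < lam1
  lam2_pos : 0 < lam2
  P1_pos : 0 < P1
  TI_pos : 0 < TI
  TE_pos : 0 < TE
  two_lt_α : 2 < α
  d_nonneg : 0 ≤ d
  ε_nonneg : 0 ≤ ε
  ε_le_sat : ε ≤ sat
  sat_pos : 0 < sat
  ρ_nonneg : 0 ≤ ρ

namespace Parameters

variable (p : Parameters)

/-- Indicator that a transmission initiated at time `u` is active at time `t`. -/
def phi (t u : ℝ) : ℝ := by
  classical exact if u ≤ t ∧ t ≤ u + p.TI then 1 else 0

/-- Path loss `(1 + l ^ α)⁻¹` at distance `l`. -/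
def pathLoss (l : ℝ) : ℝ := (1 + l ^ p.α)⁻¹

/-- The closed form
`exp(-2 λ π² T_I csc(2π/α) ((1 + P s)^(2/α) (2 P s - α) + α) / (P s (2 + α)))`. -/
def laplaceForm (lam P s : ℝ) : ℝ :=
  Real.exp (-(2 * lam * Real.pi ^ 2 * p.TI * (1 / Real.sin (2 * Real.pi / p.α)) *
    (((1 + P * s) ^ (2 / p.α) * (2 * P * s - p.α) + p.α) / (P * s * (2 + p.α)))))

end Parameters

/-- The random elements of the two networks. -/
structure Network (Ω : Type*) where
  /-- primary transmitters: location and time at which the transmission is initiated -/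
  X : ℕ → Ω → Plane × ℝ
  /-- channel coefficient from a primary transmitter to the origin -/
  h : ℕ → Ω → ℝ
  /-- position of a primary receiver relative to its paired transmitter -/
  e : ℕ → Ω → Plane
  /-- secondary transmitters: location and time -/
  Y : ℕ → Ω → Plane × ℝ
  /-- channel coefficient from a secondary transmitter to the origin -/
  g : ℕ → Ω → ℝ
  /-- whether a secondary transmitter is retained in the thinned process of active ones -/
  keep : ℕ → Ω → Bool
  /-- channel coefficient of the typical secondary link -/
  g0 : Ω → ℝ

namespace Network

variable {Ω : Type*} (N : Network Ω) (p : Parameters)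

/-- Power available at time `t` for harvesting, at a secondary transmitter at the origin. -/
def harvestPower (t : ℝ) (ω : Ω) : ℝ≥0∞ :=
  ∑' i, ENNReal.ofReal
    (p.P1 * p.phi t (N.X i ω).2 * N.h i ω * p.pathLoss ‖(N.X i ω).1‖)

/-- Energy `E_H` harvested during `[0, T_E]`. -/
def energy (ω : Ω) : ℝ≥0∞ := ∫⁻ t in Set.Icc 0 p.TE, N.harvestPower p t ω

/-- No active primary receiver lies within distance `ρ` of the origin at the end `T_E` of the
harvesting phase of the secondary transmitter there. -/
def guardZoneEmpty : Set Ω :=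
  {ω | ∀ i, (N.X i ω).2 ≤ p.TE → p.TE ≤ (N.X i ω).2 + p.TI →
    p.ρ < ‖(N.X i ω).1 + N.e i ω‖}

/-- Interference at time `t` at the origin from the primary transmitters. -/
def I1at (t : ℝ) (ω : Ω) : ℝ≥0∞ :=
  ∑' i, ENNReal.ofReal
    (p.P1 * p.phi t (N.X i ω).2 * N.h i ω * p.pathLoss ‖(N.X i ω).1‖)

/-- Primary interference averaged over `[0, T_I]`. -/
def I1 (ω : Ω) : ℝ≥0∞ := (∫⁻ t in Set.Icc 0 p.TI, N.I1at p t ω) / ENNReal.ofReal p.TI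

section Prob

variable [MeasurableSpace Ω] (Pr : Measure Ω)

/-- Energy coverage probability `π(ε) = Pr(E_H > ε)`. -/
def energyCoverage : ℝ := Pr.real {ω | ENNReal.ofReal p.ε < N.energy p ω}

/-- Transmit probability `π_s = π(ε) π_ρ` of a secondary transmitter. -/
def transmitProb : ℝ := N.energyCoverage p Pr * Pr.real (N.guardZoneEmpty p)

/-- The power at a secondary transmitter: `0` if `E_H < ε`, `𝔼[E_H] / T_I` if `ε ≤ E_H < sat`,
and `sat / T_I` if `E_H ≥ sat`. -/
def power (ω : Ω) : ℝ := by
  classical exact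
    if N.energy p ω < ENNReal.ofReal p.ε then 0
    else if N.energy p ω < ENNReal.ofReal p.sat then (∫⁻ ω', N.energy p ω' ∂Pr).toReal / p.TI
    else p.sat / p.TI

/-- Average transmit power `P₂` of the secondary transmitters. -/
def P2 : ℝ := ∫ ω, N.power p Pr ω ∂Pr

/-- Interference at time `t` at the origin from the active secondary transmitters. -/
def I2at (t : ℝ) (ω : Ω) : ℝ≥0∞ :=
  ∑' j, if N.keep j ω = true then ENNReal.ofReal
    (N.P2 p Pr * p.phi t (N.Y j ω).2 * N.g j ω * p.pathLoss ‖(N.Y j ω).1‖) else 0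

/-- Secondary interference averaged over `[0, T_I]`. -/
def I2 (ω : Ω) : ℝ≥0∞ := (∫⁻ t in Set.Icc 0 p.TI, N.I2at p Pr t ω) / ENNReal.ofReal p.TI

/-- SINR at the typical secondary receiver. -/
def SINR2 (ω : Ω) : ℝ≥0∞ :=
  ENNReal.ofReal (N.P2 p Pr * N.g0 ω * p.pathLoss p.d) /
    (N.I1 p ω + N.I2 p Pr ω + ENNReal.ofReal (p.σ ^ 2))

/-- Information coverage probability of the typical secondary receiver. -/
def coverage2 (ζ : ℝ) : ℝ := Pr.real {ω | ENNReal.ofReal ζ ≤ N.SINR2 p Pr ω}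

/-- Laplace transform of the primary interference. -/
def laplaceI1 (s : ℝ) : ℝ := ∫ ω, Real.exp (-(s * (N.I1 p ω).toReal)) ∂Pr

/-- Laplace transform of the secondary interference. -/
def laplaceI2 (s : ℝ) : ℝ := ∫ ω, Real.exp (-(s * (N.I2 p Pr ω).toReal)) ∂Pr

/-- The joint law of the random elements: two homogeneous time-space Poisson processes, Rayleigh
fading on every link, receivers at distance `d` from their transmitters with independent and
identically distributed displacements, and independent thinning of the secondary process with
retention probability `π_s`; all of these are independent. -/
structure IsModel : Prop where
  primary : IsPoissonProcess N.X (ENNReal.ofReal p.lam1 • (volume : Measure (Plane × ℝ))) Pr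
  secondary : IsPoissonProcess N.Y (ENNReal.ofReal p.lam2 • (volume : Measure (Plane × ℝ))) Pr
  measurable_h : ∀ i, Measurable (N.h i)
  measurable_e : ∀ i, Measurable (N.e i)
  measurable_g : ∀ j, Measurable (N.g j)
  measurable_keep : ∀ j, Measurable (N.keep j)
  measurable_g0 : Measurable N.g0
  law_h : ∀ i, Pr.map (N.h i) = expMeasure 1
  law_g : ∀ j, Pr.map (N.g j) = expMeasure 1
  law_g0 : Pr.map N.g0 = expMeasure 1
  norm_e : ∀ i, ∀ᵐ ω ∂Pr, ‖N.e i ω‖ = p.d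
  ident_e : ∀ i, IdentDistrib (N.e i) (N.e 0) Pr Pr
  law_keep : ∀ j, Pr.real {ω | N.keep j ω = true} = N.transmitProb p Pr
  indep_h : iIndepFun N.h Pr
  indep_e : iIndepFun N.e Pr
  indep_g : iIndepFun N.g Pr
  indep_keep : iIndepFun N.keep Pr
  /-- the seven random sequences and variables are mutually independent -/
  indep : iIndep
    ![MeasurableSpace.comap (fun ω i => N.X i ω) inferInstance,
      MeasurableSpace.comap (fun ω i => N.h i ω) inferInstance,
      MeasurableSpace.comap (fun ω i => N.e i ω) inferInstance,
      MeasurableSpace.comap (fun ω j => N.Y j ω) inferInstance,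
      MeasurableSpace.comap (fun ω j => N.g j ω) inferInstance,
      MeasurableSpace.comap (fun ω j => N.keep j ω) inferInstance,
      MeasurableSpace.comap N.g0 inferInstance] Pr

end Prob

end Network

end AdHoc

end

/-! With s = ζ(1+d^α)/P₂, the event SINR₂ ≥ ζ says g₀ ≥ s(I₁+I₂+σ²) almost surely. The exponential
tail of g₀ at an independent level turns its probability into E exp(-s(I₁+I₂+σ²)), which factorises
because the interferences are independent (`coverage2_eq`).

Averaging over [0, T_I] replaces the activity indicator by a triangular function of the starting
time, so each interference is a shot noise ∑ P·gain·fading over Poisson points (`I1_eq`, `I2_eq`).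
Fading and retention are independent marks and integrate out (`laplace_marks`): fading leaves
1/(1+b·gain) with b = Ps, and thinning multiplies the density by π_s. The Laplace functional of the
Poisson process (`laplace_functional`) leaves exp(-μ ∫ b·gain/(1+b·gain)). In that integral the
plane contributes the cosecant through Euler's reflection formula, and time contributes an
elementary integral (`exponent_eq`).

The transforms are computed with values in [0,∞], before finiteness is known. Finiteness follows by
letting the argument tend to 0 (`ae_lt_top_of_lintegral_expNeg`). Finally P₂ > 0 because one nearby
transmitter with strong fading can saturate the harvester (`measure_le_energy_pos`). -/

namespace AdHoc

open Filter Topology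

/-! ### The exponential and logarithm on [0, ∞] -/

/-- The function `x ↦ e⁻ˣ` on `[0, ∞]`. -/
noncomputable def expNeg (x : ℝ≥0∞) : ℝ≥0∞ := (EReal.exp (x : EReal))⁻¹

@[simp] lemma expNeg_zero : expNeg 0 = 1 := by simp [expNeg]

@[simp] lemma expNeg_top : expNeg ∞ = 0 := by simp [expNeg]

lemma expNeg_eq_exp_neg (x : ℝ≥0∞) : expNeg x = EReal.exp (-(x : EReal)) := by
  rw [expNeg, EReal.exp_neg]

lemma expNeg_add (x y : ℝ≥0∞) : expNeg (x + y) = expNeg x * expNeg y := by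
  have h (z : ℝ≥0∞) : EReal.exp (z : EReal) ≠ 0 := by simp
  rw [expNeg, expNeg, expNeg, EReal.coe_ennreal_add, EReal.exp_add,
    ENNReal.mul_inv (Or.inl (h x)) (Or.inr (h y))]

lemma expNeg_ofReal {r : ℝ} (hr : 0 ≤ r) :
    expNeg (ENNReal.ofReal r) = ENNReal.ofReal (Real.exp (-r)) := by
  rw [expNeg_eq_exp_neg, EReal.coe_ennreal_ofReal, max_eq_left hr, ← EReal.coe_neg,
    EReal.exp_coe]

lemma antitone_expNeg : Antitone expNeg := fun x y h => by
  rw [expNeg, expNeg, ENNReal.inv_le_inv]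
  exact EReal.exp_monotone (by exact_mod_cast h)

lemma expNeg_le_one (x : ℝ≥0∞) : expNeg x ≤ 1 := by
  simpa using antitone_expNeg (zero_le (a := x))

lemma expNeg_ne_top (x : ℝ≥0∞) : expNeg x ≠ ∞ :=
  ne_top_of_le_ne_top ENNReal.one_ne_top (expNeg_le_one x)

lemma continuous_expNeg : Continuous expNeg :=
  (EReal.expHomeomorph.continuous.comp continuous_coe_ennreal_ereal).inv

lemma measurable_expNeg : Measurable expNeg := continuous_expNeg.measurable

lemma expNeg_toReal {x : ℝ≥0∞} (hx : x ≠ ∞) :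
    (expNeg x).toReal = Real.exp (-x.toReal) := by
  conv_lhs => rw [← ENNReal.ofReal_toReal hx]
  rw [expNeg_ofReal ENNReal.toReal_nonneg, ENNReal.toReal_ofReal (Real.exp_pos _).le]

lemma expNeg_sum {ι : Type*} (s : Finset ι) (f : ι → ℝ≥0∞) :
    expNeg (∑ i ∈ s, f i) = ∏ i ∈ s, expNeg (f i) := by
  classical
  induction s using Finset.induction_on with
  | empty => simp
  | insert a s ha ih => rw [Finset.sum_insert ha, Finset.prod_insert ha, expNeg_add, ih]

lemma expNeg_mul_natCast (c : ℝ≥0∞) (k : ℕ) : expNeg (c * k) = expNeg c ^ k := by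
  have := expNeg_sum (Finset.range k) (fun _ => c)
  simpa [mul_comm] using this

lemma one_sub_le_expNeg (x : ℝ≥0∞) : 1 - x ≤ expNeg x := by
  rcases eq_or_ne x ∞ with rfl | hx
  · simp
  rw [← ENNReal.ofReal_toReal hx, expNeg_ofReal ENNReal.toReal_nonneg, ← ENNReal.ofReal_one,
    ← ENNReal.ofReal_sub _ ENNReal.toReal_nonneg]
  exact ENNReal.ofReal_le_ofReal (Real.one_sub_le_exp_neg _)

/-- The function `y ↦ -log y` on `[0, 1]`, with values in `[0, ∞]`. -/
noncomputable def negLog (y : ℝ≥0∞) : ℝ≥0∞ := (-(ENNReal.log y)).toENNReal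

lemma measurable_negLog : Measurable negLog :=
  measurable_ereal_toENNReal.comp (ENNReal.measurable_log.neg)

/-- Rewrites a product of factors in [0, 1], possibly zero, as `expNeg` of a sum, the shape to which
a Laplace functional applies. -/
lemma expNeg_negLog {y : ℝ≥0∞} (hy : y ≤ 1) : expNeg (negLog y) = y := by
  have h : 0 ≤ -(ENNReal.log y) := by
    rw [EReal.neg_nonneg]
    simpa using hy
  rw [expNeg_eq_exp_neg, negLog, EReal.coe_toENNReal h, neg_neg, ENNReal.exp_log]

/-- Points are grouped by level set. The value 0 is left out because its level set may have infinite
measure. -/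
lemma tsum_simpleFunc_comp {Ω E : Type*} [MeasurableSpace E] {X : ℕ → Ω → E}
    (u : SimpleFunc E ℝ≥0∞)
    (ω : Ω) :
    ∑' i, u (X i ω) =
      ∑ c ∈ u.range.filter (· ≠ 0), c * ({i | X i ω ∈ u ⁻¹' {c}}.encard : ℝ≥0∞) := by
  have h (c : ℝ≥0∞) : c * ({i | X i ω ∈ u ⁻¹' {c}}.encard : ℝ≥0∞) =
      ∑' i, c * Set.indicator {i | X i ω ∈ u ⁻¹' {c}} 1 i := by
    rw [ENNReal.tsum_mul_left, ← ENNReal.tsum_set_one,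
      ← tsum_subtype _ (1 : ℕ → ℝ≥0∞)]
    rfl
  simp_rw [h]
  rw [← Summable.tsum_finsetSum fun _ _ => ENNReal.summable]
  refine tsum_congr fun i => ?_
  rw [Finset.sum_filter, Finset.sum_eq_single (u (X i ω))]
  · by_cases h0 : u (X i ω) = 0 <;> simp [h0]
  · intro c _ hc
    simp [hc.symm]
  · intro hc
    exact absurd (SimpleFunc.mem_range_self u _) hc

/-! ### Laplace functional of a Poisson process -/

section Poisson

variable {Ω E : Type*} [MeasurableSpace Ω] [MeasurableSpace E]
  {X : ℕ → Ω → E} {μ : Measure E} {Pr : Measure Ω}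

lemma measurable_encard_preimage {A : Set E} (hX : ∀ i, Measurable (X i))
    (hA : MeasurableSet A) : Measurable fun ω => {i | X i ω ∈ A}.encard := by
  refine (measurable_encard (α := ℕ)).comp (measurable_set_iff.2 fun i => ?_)
  exact measurableSet_setOfPred.1 ((hX i) hA)

lemma hasSum_poisson_mul_pow (m q : ℝ) :
    HasSum (fun k : ℕ => Real.exp (-m) * m ^ k / (k.factorial : ℝ) * q ^ k)
      (Real.exp (-(m * (1 - q)))) := by
  have h := (NormedSpace.expSeries_div_hasSum_exp (m * q)).mul_left (Real.exp (-m))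
  rw [← Real.exp_eq_exp_ℝ, ← Real.exp_add] at h
  have h1 : -m + m * q = -(m * (1 - q)) := by ring
  rw [h1] at h
  refine h.congr_fun ?_
  intro k
  rw [mul_pow]
  ring

/-- The Poisson generating function at q = e⁻ᶜ; c = ∞ is allowed and gives q = 0. -/
theorem IsPoissonProcess.lintegral_expNeg_mul_encard [IsProbabilityMeasure Pr]
    (hX : IsPoissonProcess X μ Pr) {A : Set E} (hA : MeasurableSet A) (hfin : μ A < ∞)
    (c : ℝ≥0∞) :
    ∫⁻ ω, expNeg (c * ({i | X i ω ∈ A}.encard : ℝ≥0∞)) ∂Pr =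
      expNeg ((1 - expNeg c) * μ A) := by
  set m : ℝ := (μ A).toReal with hmdef
  have hm : 0 ≤ m := ENNReal.toReal_nonneg
  set q : ℝ := (expNeg c).toReal
  have hq : 0 ≤ q := ENNReal.toReal_nonneg
  have hcq : expNeg c = ENNReal.ofReal q := (ENNReal.ofReal_toReal (expNeg_ne_top c)).symm
  have hq1 : q ≤ 1 := by
    have := ENNReal.toReal_mono ENNReal.one_ne_top (expNeg_le_one c)
    simpa using this
  have hN := measurable_encard_preimage hX.measurable hA
  set S : ℕ → Set Ω := fun k => {ω | {i | X i ω ∈ A}.encard = k} with hS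
  have hSm (k : ℕ) : MeasurableSet (S k) := hN (measurableSet_singleton (k : ℕ∞))
  have hSd : Pairwise (Function.onFun Disjoint S) := fun k l hkl =>
    Set.disjoint_left.2 fun ω (hk : _ = _) (hl : _ = _) =>
      hkl (by exact_mod_cast hk.symm.trans hl)
  have hsum (r : ℝ) (hr : 0 ≤ r) :
      ∑' k : ℕ, ENNReal.ofReal r ^ k * Pr (S k) =
        ENNReal.ofReal (Real.exp (-(m * (1 - r)))) := by
    rw [← (hasSum_poisson_mul_pow m r).tsum_eq, ENNReal.ofReal_tsum_of_nonneg
      (fun k => by positivity) (hasSum_poisson_mul_pow m r).summable]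
    refine tsum_congr fun k => ?_
    rw [ENNReal.ofReal_mul (by positivity), ENNReal.ofReal_pow hr, mul_comm, hS,
      hX.poisson A hA hfin k]
  -- At q = 1 the Poisson masses sum to 1, so the count is almost surely finite and the value `⊤` of
  -- `encard` can be ignored.
  have hone : Pr (⋃ k, S k) = 1 := by
    have h2 := hsum 1 zero_le_one
    rw [measure_iUnion hSd hSm]
    simpa using h2
  have hae : ∀ᵐ ω ∂Pr, ω ∈ ⋃ k, S k :=
    (prob_compl_eq_zero_iff (MeasurableSet.iUnion hSm)).2 hone
  have : (1 - expNeg c) * μ A = ENNReal.ofReal (m * (1 - q)) := by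
    rw [hcq, ← ENNReal.ofReal_one, ← ENNReal.ofReal_sub _ hq, ← ENNReal.ofReal_toReal hfin.ne,
      ← ENNReal.ofReal_mul (by linarith), mul_comm]
  rw [this, expNeg_ofReal (mul_nonneg hm (by linarith)), ← hsum q hq,
    ← Measure.restrict_eq_self_of_ae_mem hae, lintegral_iUnion hSm hSd,
    Measure.restrict_eq_self_of_ae_mem hae]
  refine tsum_congr fun k => ?_
  rw [← hcq, ← setLIntegral_const]
  refine setLIntegral_congr_fun (hSm k) fun ω hω => ?_
  have hω' : {i | X i ω ∈ A}.encard = k := hω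
  simp only [hω', ENat.toENNReal_coe, expNeg_mul_natCast]

/-- Level sets are disjoint, so their counts are independent and the generating functions multiply;
the exponents add up to the integral of a simple function. -/
theorem IsPoissonProcess.laplace_simpleFunc [IsProbabilityMeasure Pr]
    (hX : IsPoissonProcess X μ Pr) (u : SimpleFunc E ℝ≥0∞) (hu : ∀ c ≠ 0, μ (u ⁻¹' {c}) < ∞) :
    ∫⁻ ω, expNeg (∑' i, u (X i ω)) ∂Pr = expNeg (∫⁻ x, (1 - expNeg (u x)) ∂μ) := by
  set R : Finset ℝ≥0∞ := u.range.filter (· ≠ 0) with hR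
  let e : Fin R.card ≃ R := R.equivFin.symm
  let A : Fin R.card → Set E := fun k => u ⁻¹' {(e k : ℝ≥0∞)}
  have hA (k) : MeasurableSet (A k) := u.measurableSet_preimage _
  have hd : Pairwise fun k l => Disjoint (A k) (A l) := fun k l hkl =>
    Disjoint.preimage _ (Set.disjoint_singleton.2 fun h => hkl (e.injective (Subtype.ext h)))
  have hsum (F : ℝ≥0∞ → ℝ≥0∞) : ∑ c ∈ R, F c = ∑ k, F (e k) := by
    rw [← Finset.sum_coe_sort]
    exact (Equiv.sum_comp e fun c : R => F c).symm
  have hind := (hX.indep R.card A hA hd).comp (fun k n => expNeg ((e k : ℝ≥0∞) * n))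
    (fun k => measurable_of_countable _)
  have hmeas (k) : Measurable
      ((fun n : ℕ∞ => expNeg ((e k : ℝ≥0∞) * n)) ∘ fun ω => {i | X i ω ∈ A k}.encard) :=
    (measurable_of_countable _).comp (measurable_encard_preimage hX.measurable (hA k))
  have hR0 (k) : (e k : ℝ≥0∞) ≠ 0 := (Finset.mem_filter.1 (e k).2).2
  simp_rw [tsum_simpleFunc_comp, ← hR, hsum, expNeg_sum]
  refine (lintegral_prod_eq_prod_lintegral_of_indepFun Finset.univ _ hind hmeas).trans ?_
  simp only [Function.comp_apply]
  simp_rw [hX.lintegral_expNeg_mul_encard (hA _) (hu _ (hR0 _)), ← expNeg_sum]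
  congr 1
  have h1 : ∫⁻ x, (1 - expNeg (u x)) ∂μ = (u.map fun c => 1 - expNeg c).lintegral μ := by
    rw [← SimpleFunc.lintegral_eq_lintegral]
    rfl
  rw [h1, SimpleFunc.map_lintegral, ← hsum fun c => (1 - expNeg c) * μ (u ⁻¹' {c}), hR,
    Finset.sum_filter]
  refine Finset.sum_congr rfl fun c _ => ?_
  by_cases hc : c = 0 <;> simp [hc]

/-- The Laplace functional of a Poisson process. -/
theorem IsPoissonProcess.laplace_functional [IsProbabilityMeasure Pr] [SigmaFinite μ]
    (hX : IsPoissonProcess X μ Pr) {u : E → ℝ≥0∞} (hu : Measurable u) :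
    ∫⁻ ω, expNeg (∑' i, u (X i ω)) ∂Pr = expNeg (∫⁻ x, (1 - expNeg (u x)) ∂μ) := by
  -- Cutting off outside a set of finite measure makes every nonzero level set finite while the
  -- approximations still increase to u.
  let v : ℕ → SimpleFunc E ℝ≥0∞ := fun n =>
    (SimpleFunc.eapprox u n).restrict (spanningSets μ n)
  have hv (n x) : v n x = (spanningSets μ n).indicator (SimpleFunc.eapprox u n) x :=
    SimpleFunc.restrict_apply _ (measurableSet_spanningSets μ n) x
  have hmono (x) : Monotone fun n => v n x := fun n k hnk => by
    simp only [hv]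
    refine (Set.indicator_le_indicator_of_subset (monotone_spanningSets μ hnk)
      (fun _ => zero_le) x).trans (Set.indicator_le_indicator ?_)
    exact SimpleFunc.monotone_eapprox u hnk x
  have hlim (x) : Tendsto (fun n => v n x) atTop (𝓝 (u x)) := by
    refine (SimpleFunc.tendsto_eapprox hu x).congr' ?_
    filter_upwards [eventually_ge_atTop (spanningSetsIndex μ x)] with n hn
    rw [hv, Set.indicator_of_mem
      (monotone_spanningSets μ hn (mem_spanningSetsIndex μ x))]
  have hfin (n) (c : ℝ≥0∞) (hc : c ≠ 0) : μ (v n ⁻¹' {c}) < ∞ := by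
    refine (measure_mono fun x hx => ?_).trans_lt (measure_spanningSets_lt_top μ n)
    by_contra hx'
    have : v n x = c := hx
    rw [hv, Set.indicator_of_notMem hx'] at this
    exact hc this.symm
  have hleft : Tendsto (fun n => ∫⁻ ω, expNeg (∑' i, v n (X i ω)) ∂Pr) atTop
      (𝓝 (∫⁻ ω, expNeg (∑' i, u (X i ω)) ∂Pr)) := by
    refine tendsto_lintegral_of_dominated_convergence 1 (fun n => ?_)
      (fun n => Eventually.of_forall fun ω => expNeg_le_one _) (by simp)
      (Eventually.of_forall fun ω => ?_)
    · exact measurable_expNeg.comp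
        (Measurable.tsum fun i => (v n).measurable.comp (hX.measurable i))
    · refine (continuous_expNeg.tendsto _).comp ?_
      -- The sum over points is an integral for the counting measure, so monotone convergence
      -- applies.
      simp_rw [← lintegral_count]
      exact lintegral_tendsto_of_tendsto_of_monotone
        (fun n => (measurable_of_countable _).aemeasurable)
        (Eventually.of_forall fun i => hmono _) (Eventually.of_forall fun i => hlim _)
  have hright : Tendsto (fun n => expNeg (∫⁻ x, (1 - expNeg (v n x)) ∂μ)) atTop
      (𝓝 (expNeg (∫⁻ x, (1 - expNeg (u x)) ∂μ))) := by
    refine (continuous_expNeg.tendsto _).comp (lintegral_tendsto_of_tendsto_of_monotone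
      (fun n => ?_) (Eventually.of_forall fun x n k hnk => ?_) (Eventually.of_forall fun x => ?_))
    · exact (measurable_const.sub (measurable_expNeg.comp (v n).measurable)).aemeasurable
    · exact tsub_le_tsub_left (antitone_expNeg (hmono x hnk)) 1
    · exact ENNReal.Tendsto.sub tendsto_const_nhds ((continuous_expNeg.tendsto _).comp (hlim x))
        (Or.inl ENNReal.one_ne_top)
  simp_rw [hX.laplace_simpleFunc (v _) (hfin _)] at hleft
  exact tendsto_nhds_unique hleft hright

/-- Otherwise the count in A would vanish almost surely, whereas this has probability e^{-μ(A)} < 1.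
-/
lemma IsPoissonProcess.exists_measure_preimage_pos [IsProbabilityMeasure Pr]
    (hX : IsPoissonProcess X μ Pr) {A : Set E}
    (hA : MeasurableSet A) (hfin : μ A < ∞) (hpos : 0 < μ A) : ∃ i, 0 < Pr (X i ⁻¹' A) := by
  by_contra! h
  have h0 (i) : Pr (X i ⁻¹' A) = 0 := nonpos_iff_eq_zero.1 (h i)
  have h1 : ∀ᵐ ω ∂Pr, ∀ i, X i ω ∉ A := ae_all_iff.2 fun i => measure_eq_zero_iff_ae_notMem.1 (h0 i)
  have h2 : Pr {ω | {i | X i ω ∈ A}.encard = (0 : ℕ)} = 1 := by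
    rw [← measure_univ (μ := Pr)]
    refine measure_congr (eventuallyEq_univ.2 (h1.mono fun ω hω => ?_))
    simpa [Set.eq_empty_iff_forall_notMem] using hω
  rw [hX.poisson A hA hfin 0] at h2
  have h3 : Real.exp (-(μ A).toReal) < 1 := by
    rw [Real.exp_lt_one_iff]
    linarith [ENNReal.toReal_pos hpos.ne' hfin.ne]
  have h4 : ENNReal.ofReal (Real.exp (-(μ A).toReal)) < 1 := by simpa using h3
  refine h4.ne ?_
  simpa only [pow_zero, Nat.factorial_zero, Nat.cast_one, mul_one, div_one] using h2

end Poisson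

/-! ### Independent marks -/

section Marks

variable {Ω E S : Type*} [MeasurableSpace Ω] [MeasurableSpace E] [MeasurableSpace S]
  {X : ℕ → Ω → E} {M : ℕ → Ω → S} {Pr : Measure Ω} {ν : Measure S}

/-- The joint law of points and marks is a product; once the points are frozen, the marks are
independent and the product factorises. -/
lemma lintegral_prod_marks [IsProbabilityMeasure Pr] [SFinite ν] (hX : ∀ i, Measurable (X i))
    (hM : ∀ i, Measurable (M i)) (hlaw : ∀ i, Pr.map (M i) = ν) (hind : iIndepFun M Pr)
    (hXM : IndepFun (fun ω i => X i ω) (fun ω i => M i ω) Pr) {F : E × S → ℝ≥0∞}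
    (hF : Measurable F) (s : Finset ℕ) :
    ∫⁻ ω, ∏ i ∈ s, F (X i ω, M i ω) ∂Pr = ∫⁻ ω, ∏ i ∈ s, ∫⁻ m, F (X i ω, m) ∂ν ∂Pr := by
  have hX' : Measurable fun ω i => X i ω := measurable_pi_iff.2 hX
  have hM' : Measurable fun ω i => M i ω := measurable_pi_iff.2 hM
  have hG : Measurable fun z : (ℕ → E) × (ℕ → S) => ∏ i ∈ s, F (z.1 i, z.2 i) :=
    Finset.measurable_prod _ fun i _ => hF.comp (by fun_prop)
  have hG2 : Measurable fun x : ℕ → E => ∏ i ∈ s, ∫⁻ m, F (x i, m) ∂ν :=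
    Finset.measurable_prod _ fun i _ => hF.lintegral_prod_right'.comp (measurable_pi_apply i)
  have h1 := (indepFun_iff_map_prod_eq_prod_map_map hX'.aemeasurable hM'.aemeasurable).1 hXM
  have := Measure.isProbabilityMeasure_map (μ := Pr) hM'.aemeasurable
  calc ∫⁻ ω, ∏ i ∈ s, F (X i ω, M i ω) ∂Pr
      = ∫⁻ z, ∏ i ∈ s, F (z.1 i, z.2 i) ∂(Pr.map fun ω => (fun i => X i ω, fun i => M i ω)) :=
        (lintegral_map hG (hX'.prodMk hM')).symm
    _ = ∫⁻ x, ∏ i ∈ s, ∫⁻ m, F (x i, m) ∂ν ∂(Pr.map fun ω i => X i ω) := by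
        rw [h1, lintegral_prod _ hG.aemeasurable]
        refine lintegral_congr fun x => ?_
        rw [lintegral_map (f := fun m : ℕ → S => ∏ i ∈ s, F (x i, m i))
          (hG.comp measurable_prodMk_left) hM']
        have hF' (i) : Measurable fun m => F (x i, m) := hF.comp measurable_prodMk_left
        refine (lintegral_prod_eq_prod_lintegral_of_indepFun s _
          (hind.comp (fun i m => F (x i, m)) hF') fun i => (hF' i).comp (hM i)).trans ?_
        refine Finset.prod_congr rfl fun i _ => ?_
        rw [← hlaw i, lintegral_map (hF' i) (hM i)]
        rfl
    _ = _ := lintegral_map hG2 hX'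

/-- Independent marks can be integrated out of a Laplace functional. -/
theorem laplace_marks [IsProbabilityMeasure Pr] [IsProbabilityMeasure ν]
    (hX : ∀ i, Measurable (X i))
    (hM : ∀ i, Measurable (M i)) (hlaw : ∀ i, Pr.map (M i) = ν) (hind : iIndepFun M Pr)
    (hXM : IndepFun (fun ω i => X i ω) (fun ω i => M i ω) Pr) {f : E × S → ℝ≥0∞}
    (hf : Measurable f) :
    ∫⁻ ω, expNeg (∑' i, f (X i ω, M i ω)) ∂Pr =
      ∫⁻ ω, expNeg (∑' i, negLog (∫⁻ m, expNeg (f (X i ω, m)) ∂ν)) ∂Pr := by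
  -- Both sides are limits of finite products bounded by 1, which reduces the claim to finitely many
  -- marks.
  have hlim (F : ℕ → Ω → ℝ≥0∞) (hF : ∀ i, Measurable (F i)) :
      Tendsto (fun n => ∫⁻ ω, ∏ i ∈ Finset.range n, expNeg (F i ω) ∂Pr) atTop
        (𝓝 (∫⁻ ω, expNeg (∑' i, F i ω) ∂Pr)) := by
    simp_rw [← expNeg_sum]
    refine tendsto_lintegral_of_dominated_convergence 1 (fun n => ?_)
      (fun n => Eventually.of_forall fun ω => expNeg_le_one _) (by simp)
      (Eventually.of_forall fun ω => ?_)
    · exact measurable_expNeg.comp (Finset.measurable_sum _ fun i _ => hF i)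
    · exact (continuous_expNeg.tendsto _).comp (ENNReal.tendsto_nat_tsum _)
  have hψ : Measurable fun x => ∫⁻ m, expNeg (f (x, m)) ∂ν :=
    (measurable_expNeg.comp hf).lintegral_prod_right'
  have h1 (x : E) : ∫⁻ m, expNeg (f (x, m)) ∂ν ≤ 1 :=
    (lintegral_mono fun m => expNeg_le_one _).trans (by simp)
  refine tendsto_nhds_unique (hlim _ fun i => hf.comp ((hX i).prodMk (hM i))) ?_
  refine (hlim _ fun i => measurable_negLog.comp (hψ.comp (hX i))).congr fun n => ?_
  simp only [Function.comp_apply, expNeg_negLog (h1 _)]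
  exact (lintegral_prod_marks hX hM hlaw hind hXM (measurable_expNeg.comp hf) _).symm

end Marks

/-! ### The integral over the plane -/

lemma lintegral_plane_exp_neg_mul_rpow {α y : ℝ} (hα : 0 < α) (hy : 0 < y) :
    ∫⁻ x : Plane, ENNReal.ofReal (Real.exp (-y * ‖x‖ ^ α)) =
      ENNReal.ofReal (2 * Real.pi / α * Real.Gamma (2 / α) * y ^ (-(2 / α))) := by
  have hfr : Module.finrank ℝ Plane = 2 := by simp
  have hvol : (volume : Measure Plane).real (Metric.ball 0 1) = Real.pi := by
    rw [Measure.real, EuclideanSpace.volume_ball_fin_two]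
    simp [Real.pi_pos.le]
  have heq : Set.EqOn (fun r : ℝ => r ^ (1 : ℝ) * Real.exp (-y * r ^ α))
      (fun r : ℝ => r ^ (Module.finrank ℝ Plane - 1) • Real.exp (-y * r ^ α)) (Set.Ioi 0) := by
    intro r _
    simp [hfr]
  have hint : Integrable (fun x : Plane => Real.exp (-y * ‖x‖ ^ α)) := by
    rw [integrable_fun_norm_addHaar volume (f := fun r => Real.exp (-y * r ^ α))]
    refine IntegrableOn.congr_fun ?_ heq measurableSet_Ioi
    exact integrableOn_rpow_mul_exp_neg_mul_rpow (by norm_num) hα hy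
  rw [← ofReal_integral_eq_lintegral_ofReal hint
      (Eventually.of_forall fun x => (Real.exp_pos _).le),
    integral_fun_norm_addHaar volume (fun r => Real.exp (-y * r ^ α)), hvol,
    ← setIntegral_congr_fun measurableSet_Ioi heq,
    integral_rpow_mul_exp_neg_mul_rpow hα (by norm_num) hy, hfr]
  congr 1
  norm_num [neg_div]
  ring

lemma lintegral_Ioi_exp_neg_mul {c : ℝ} (hc : 0 < c) :
    ∫⁻ y in Set.Ioi (0 : ℝ), ENNReal.ofReal (Real.exp (-(c * y))) = ENNReal.ofReal c⁻¹ := by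
  have hint : IntegrableOn (fun y : ℝ => Real.exp (-c * y)) (Set.Ioi 0) :=
    integrableOn_exp_mul_Ioi (by linarith) 0
  have := integral_exp_mul_Ioi (a := -c) (by linarith) 0
  simp only [neg_mul] at hint this
  rw [← ofReal_integral_eq_lintegral_ofReal hint
      (Eventually.of_forall fun x => (Real.exp_pos _).le),
    this]
  simp

/-- Write 1/(c+r^α) as ∫ e^{-(c+r^α)y} dy and exchange integrals. The plane gives Γ(2/α) y^{-2/α};
the y-integral gives Γ(1-2/α), finite because α > 2. The reflection formula turns the product into
the cosecant. -/
lemma lintegral_plane_inv_add_rpow {α c : ℝ} (hα : 2 < α) (hc : 0 < c) :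
    ∫⁻ x : Plane, ENNReal.ofReal (c + ‖x‖ ^ α)⁻¹ =
      ENNReal.ofReal (2 * Real.pi ^ 2 / α * (1 / Real.sin (2 * Real.pi / α)) *
        c ^ (2 / α - 1)) := by
  have hα0 : 0 < α := by linarith
  have hδ : 2 / α < 1 := (div_lt_one hα0).2 hα
  have hδ0 : 0 < 2 / α := by positivity
  have h1 (x : Plane) : ENNReal.ofReal (c + ‖x‖ ^ α)⁻¹ =
      ∫⁻ y in Set.Ioi (0 : ℝ), ENNReal.ofReal (Real.exp (-((c + ‖x‖ ^ α) * y))) :=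
    (lintegral_Ioi_exp_neg_mul (by positivity)).symm
  simp_rw [h1]
  rw [lintegral_lintegral_swap]
  swap
  · refine Measurable.aemeasurable ?_
    unfold Function.uncurry
    fun_prop
  have h2 : ∀ y ∈ Set.Ioi (0 : ℝ),
      ∫⁻ x : Plane, ENNReal.ofReal (Real.exp (-((c + ‖x‖ ^ α) * y))) =
      ENNReal.ofReal (2 * Real.pi / α * Real.Gamma (2 / α) *
        (y ^ ((1 - 2 / α) - 1) * Real.exp (-(c * y)))) := by
    intro y hy
    have h3 (x : Plane) : ENNReal.ofReal (Real.exp (-((c + ‖x‖ ^ α) * y))) =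
        ENNReal.ofReal (Real.exp (-(c * y))) * ENNReal.ofReal (Real.exp (-y * ‖x‖ ^ α)) := by
      rw [← ENNReal.ofReal_mul (Real.exp_pos _).le, ← Real.exp_add]
      ring_nf
    simp_rw [h3]
    rw [lintegral_const_mul' _ _ ENNReal.ofReal_ne_top, lintegral_plane_exp_neg_mul_rpow hα0 hy,
      ← ENNReal.ofReal_mul (Real.exp_pos _).le]
    congr 1
    rw [show (1 - 2 / α) - 1 = -(2 / α) by ring]
    ring
  rw [setLIntegral_congr_fun measurableSet_Ioi h2]
  have hΓ : 0 < Real.Gamma (2 / α) := Real.Gamma_pos_of_pos hδ0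
  have hint : IntegrableOn (fun y : ℝ => y ^ ((1 - 2 / α) - 1) * Real.exp (-(c * y)))
      (Set.Ioi 0) := by
    have := integrableOn_rpow_mul_exp_neg_mul_rpow (p := 1) (s := (1 - 2 / α) - 1) (b := c)
      (by linarith) one_pos hc
    simpa only [Real.rpow_one, neg_mul] using this
  rw [← ofReal_integral_eq_lintegral_ofReal (hint.const_mul _) ?_, integral_const_mul,
    Real.integral_rpow_mul_exp_neg_mul_Ioi (by linarith) hc]
  · congr 1
    have := Real.Gamma_mul_Gamma_one_sub (2 / α)
    rw [show Real.pi * (2 / α) = 2 * Real.pi / α by ring] at this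
    rw [one_div, Real.inv_rpow hc.le, ← Real.rpow_neg hc.le, neg_sub]
    calc _ = 2 * Real.pi / α * (Real.Gamma (2 / α) * Real.Gamma (1 - 2 / α)) *
          c ^ (2 / α - 1) := by ring
      _ = _ := by rw [this]; ring
  · refine (ae_restrict_mem measurableSet_Ioi).mono fun y hy => ?_
    have : (0 : ℝ) < y := hy
    simp only [Pi.zero_apply]
    positivity

/-! ### The integral over starting times -/

/-- The fraction of `[0, T]` during which a transmission of duration `T` initiated at time `u`
is active. -/
noncomputable def overlap (T u : ℝ) : ℝ := max 0 (1 - |u| / T)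

lemma overlap_nonneg (T u : ℝ) : 0 ≤ overlap T u := le_max_left _ _

lemma overlap_le_one {T : ℝ} (hT : 0 < T) (u : ℝ) : overlap T u ≤ 1 :=
  max_le zero_le_one (by have : 0 ≤ |u| / T := by positivity
                         linarith)

@[fun_prop]
lemma continuous_overlap (T : ℝ) : Continuous (overlap T) := by
  unfold overlap
  fun_prop

/-- With v = 1 + b(1-u/T) the integrand is (v-1)v^{δ-1} = v^δ - v^{δ-1}, and dv = -(b/T) du. -/
lemma integral_mul_one_add_rpow {b δ T : ℝ} (hb : 0 < b) (hδ : 0 < δ) (hT : 0 < T) :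
    ∫ u in (0 : ℝ)..T, b * (1 - u / T) * (1 + b * (1 - u / T)) ^ (δ - 1) =
      T * ((1 + b) ^ δ * ((1 + b) / (δ + 1) - 1 / δ) + 1 / δ - 1 / (δ + 1)) / b := by
  have hbase : ∀ u ∈ Set.uIcc 0 T, 0 < 1 + b * (1 - u / T) := by
    intro u hu
    rw [Set.uIcc_of_le hT.le] at hu
    have : u / T ≤ 1 := (div_le_one hT).2 hu.2
    have : 0 ≤ b * (1 - u / T) := mul_nonneg hb.le (by linarith)
    linarith
  have hderiv : ∀ u ∈ Set.uIcc 0 T, HasDerivAt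
      (fun u => -(T / b) * ((1 + b * (1 - u / T)) ^ (δ + 1) / (δ + 1) -
        (1 + b * (1 - u / T)) ^ δ / δ))
      (b * (1 - u / T) * (1 + b * (1 - u / T)) ^ (δ - 1)) u := by
    intro u hu
    have h0 := hbase u hu
    have hlin : HasDerivAt (fun u : ℝ => 1 + b * (1 - u / T)) (b * (-(1 / T))) u := by
      simpa using ((((hasDerivAt_id u).div_const T).const_sub 1).const_mul b).const_add 1
    have h1 := (hlin.rpow_const (p := δ + 1) (Or.inl h0.ne')).div_const (δ + 1)
    have h2 := (hlin.rpow_const (p := δ) (Or.inl h0.ne')).div_const δ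
    refine ((h1.sub h2).const_mul (-(T / b))).congr_deriv ?_
    have h3 : (1 + b * (1 - u / T)) ^ (δ + 1 - 1) =
        (1 + b * (1 - u / T)) ^ (δ - 1) * (1 + b * (1 - u / T)) := by
      rw [show δ + 1 - 1 = (δ - 1) + 1 by ring, Real.rpow_add_one h0.ne']
    rw [h3]
    have : δ + 1 ≠ 0 := by positivity
    field_simp
    ring
  rw [intervalIntegral.integral_eq_sub_of_hasDerivAt hderiv]
  · have hT' : T / T = 1 := div_self hT.ne'
    simp only [hT', zero_div, sub_self, mul_zero, add_zero, sub_zero, mul_one, Real.one_rpow]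
    rw [Real.rpow_add_one (by positivity)]
    have : δ + 1 ≠ 0 := by positivity
    field_simp
    ring
  · refine ContinuousOn.intervalIntegrable ?_
    refine ContinuousOn.mul (by fun_prop) (ContinuousOn.rpow_const (by fun_prop) ?_)
    exact fun u hu => Or.inl (hbase u hu).ne'

/-- The integrand is even and vanishes for |u| ≥ T, hence twice the integral over [0, T]. -/
lemma lintegral_overlap {b δ T : ℝ} (hb : 0 < b) (hδ : 0 < δ) (hT : 0 < T) :
    ∫⁻ u, ENNReal.ofReal (b * overlap T u * (1 + b * overlap T u) ^ (δ - 1)) =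
      ENNReal.ofReal
        (2 * (T * ((1 + b) ^ δ * ((1 + b) / (δ + 1) - 1 / δ) + 1 / δ - 1 / (δ + 1)) / b)) := by
  have hpos (u) : 0 < 1 + b * overlap T u := by
    have := mul_nonneg hb.le (overlap_nonneg T u)
    linarith
  have hcont : Continuous fun u => b * overlap T u * (1 + b * overlap T u) ^ (δ - 1) := by
    refine Continuous.mul (by fun_prop) (Continuous.rpow_const (by fun_prop) ?_)
    exact fun u => Or.inl (hpos u).ne'
  have hzero (u : ℝ) (hu : T ≤ |u|) : overlap T u = 0 :=
    max_eq_left (by have := (one_le_div hT).2 hu; linarith)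
  have hsupp : HasCompactSupport
      fun u => b * overlap T u * (1 + b * overlap T u) ^ (δ - 1) := by
    refine HasCompactSupport.of_support_subset_isCompact (isCompact_Icc (a := -T) (b := T)) ?_
    intro u hu
    rw [Set.mem_Icc, ← abs_le]
    by_contra h
    exact hu (by simp [hzero u (le_of_not_ge h)])
  rw [← ofReal_integral_eq_lintegral_ofReal (hcont.integrable_of_hasCompactSupport hsupp)
    (Eventually.of_forall fun u => mul_nonneg (mul_nonneg hb.le (overlap_nonneg T u))
      (Real.rpow_nonneg (hpos u).le _))]
  congr 1
  have habs (u : ℝ) : overlap T |u| = overlap T u := by simp [overlap]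
  have := integral_comp_abs (f := fun u => b * overlap T u * (1 + b * overlap T u) ^ (δ - 1))
  simp only [habs] at this
  rw [this, ← integral_mul_one_add_rpow hb hδ hT, intervalIntegral.integral_of_le hT.le]
  congr 1
  rw [← integral_indicator measurableSet_Ioi, ← integral_indicator measurableSet_Ioc]
  congr 1
  ext u
  by_cases h0 : 0 < u
  · by_cases h1 : u ≤ T
    · have : overlap T u = 1 - u / T := by
        rw [overlap, abs_of_pos h0, max_eq_right]
        have := (div_le_one hT).2 h1
        linarith
      rw [Set.indicator_of_mem (show u ∈ Set.Ioi 0 from h0),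
        Set.indicator_of_mem (show u ∈ Set.Ioc 0 T from ⟨h0, h1⟩), this]
    · rw [Set.indicator_of_mem (show u ∈ Set.Ioi 0 from h0),
        Set.indicator_of_notMem (fun h => h1 h.2),
        hzero u ((le_of_not_ge h1).trans (le_abs_self u))]
      simp
  · rw [Set.indicator_of_notMem (show u ∉ Set.Ioi 0 from h0),
      Set.indicator_of_notMem (fun h => h0 h.1)]

/-! ### Closed form of the Laplace exponent -/

namespace Parameters

variable (p : Parameters)

/-- Mean contribution to the averaged interference, per unit of power, of a transmitter at the
given location and time. -/
noncomputable def gain (z : Plane × ℝ) : ℝ := overlap p.TI z.2 * p.pathLoss ‖z.1‖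

lemma pathLoss_pos {l : ℝ} (hl : 0 ≤ l) : 0 < p.pathLoss l := by
  unfold pathLoss
  positivity

lemma pathLoss_le_one {l : ℝ} (hl : 0 ≤ l) : p.pathLoss l ≤ 1 :=
  inv_le_one_of_one_le₀ (by have := Real.rpow_nonneg hl p.α; linarith)

lemma gain_nonneg (z) : 0 ≤ p.gain z :=
  mul_nonneg (overlap_nonneg _ _) (p.pathLoss_pos (norm_nonneg _)).le

lemma gain_le_one (z) : p.gain z ≤ 1 :=
  mul_le_one₀ (overlap_le_one p.TI_pos _) (p.pathLoss_pos (norm_nonneg _)).le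
    (p.pathLoss_le_one (norm_nonneg _))

lemma measurable_gain : Measurable p.gain := by
  unfold gain pathLoss
  fun_prop

lemma sin_pos : 0 < Real.sin (2 * Real.pi / p.α) := by
  have hα := p.two_lt_α
  refine Real.sin_pos_of_pos_of_lt_pi (by positivity) ?_
  rw [div_lt_iff₀ (by linarith)]
  nlinarith [Real.pi_pos]

lemma closedForm_eq {b : ℝ} (hb : 0 < b) :
    p.α * p.TI * (((1 + b) ^ (2 / p.α) * (2 * b - p.α) + p.α) / (b * (2 + p.α))) =
      2 * (p.TI * ((1 + b) ^ (2 / p.α) * ((1 + b) / (2 / p.α + 1) - 1 / (2 / p.α)) +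
        1 / (2 / p.α) - 1 / (2 / p.α + 1)) / b) := by
  have hα0 : 0 < p.α := by linarith [p.two_lt_α]
  have : 2 + p.α ≠ 0 := by positivity
  field_simp
  ring

/-- The sign is not visible in the formula; it comes from the integral of a nonnegative function
that the formula evaluates. -/
lemma closedForm_nonneg {b : ℝ} (hb : 0 < b) :
    0 ≤ ((1 + b) ^ (2 / p.α) * (2 * b - p.α) + p.α) / (b * (2 + p.α)) := by
  have hα0 : 0 < p.α := by linarith [p.two_lt_α]
  refine nonneg_of_mul_nonneg_right (a := p.α * p.TI) ?_ (mul_pos hα0 p.TI_pos)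
  rw [p.closedForm_eq hb, ← integral_mul_one_add_rpow hb (by positivity) p.TI_pos]
  refine mul_nonneg zero_le_two (intervalIntegral.integral_nonneg p.TI_pos.le fun u hu => ?_)
  have : u / p.TI ≤ 1 := (div_le_one p.TI_pos).2 hu.2
  have : 0 ≤ b * (1 - u / p.TI) := mul_nonneg hb.le (by linarith)
  positivity

/-- The exponent of the Laplace transform of an interference. -/
noncomputable def exponent (b : ℝ) : ℝ≥0∞ :=
  ∫⁻ z : Plane × ℝ, ENNReal.ofReal (b * p.gain z / (1 + b * p.gain z))

/-- For a fixed time put w = b·overlap: the integrand is w/(1+w+‖x‖^α), so the plane integral is a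
constant times w(1+w)^{2/α-1}, which is then integrated over time. -/
lemma exponent_eq {b : ℝ} (hb : 0 < b) :
    p.exponent b = ENNReal.ofReal (2 * Real.pi ^ 2 * p.TI * (1 / Real.sin (2 * Real.pi / p.α)) *
      (((1 + b) ^ (2 / p.α) * (2 * b - p.α) + p.α) / (b * (2 + p.α)))) := by
  have hα := p.two_lt_α
  have hα0 : 0 < p.α := by linarith
  have hsin := p.sin_pos
  rw [exponent, Measure.volume_eq_prod, lintegral_prod_symm']
  swap
  · exact (((p.measurable_gain.const_mul b).div
      ((p.measurable_gain.const_mul b).const_add 1))).ennreal_ofReal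
  have hw (t : ℝ) : 0 ≤ b * overlap p.TI t := mul_nonneg hb.le (overlap_nonneg _ _)
  have h1 (t : ℝ) : ∫⁻ x : Plane, ENNReal.ofReal (b * p.gain (x, t) / (1 + b * p.gain (x, t))) =
      ENNReal.ofReal (2 * Real.pi ^ 2 / p.α * (1 / Real.sin (2 * Real.pi / p.α))) *
        ENNReal.ofReal (b * overlap p.TI t * (1 + b * overlap p.TI t) ^ (2 / p.α - 1)) := by
    have h2 (x : Plane) : ENNReal.ofReal (b * p.gain (x, t) / (1 + b * p.gain (x, t))) =
        ENNReal.ofReal (b * overlap p.TI t) *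
          ENNReal.ofReal ((1 + b * overlap p.TI t) + ‖x‖ ^ p.α)⁻¹ := by
      rw [← ENNReal.ofReal_mul (hw t)]
      congr 1
      have hx : 0 ≤ ‖x‖ ^ p.α := by positivity
      have := hw t
      simp only [gain, pathLoss]
      field_simp
      ring
    simp_rw [h2]
    rw [lintegral_const_mul' _ _ ENNReal.ofReal_ne_top,
      lintegral_plane_inv_add_rpow hα (by have := hw t; linarith), ← ENNReal.ofReal_mul (hw t),
      ← ENNReal.ofReal_mul (by positivity)]
    congr 1
    ring
  simp_rw [h1]
  rw [lintegral_const_mul' _ _ ENNReal.ofReal_ne_top, lintegral_overlap hb (by positivity) p.TI_pos,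
    ← ENNReal.ofReal_mul (by positivity)]
  rw [← p.closedForm_eq hb]
  congr 1
  field_simp

lemma exponent_ne_top {b : ℝ} (hb : 0 < b) : p.exponent b ≠ ∞ := by
  rw [p.exponent_eq hb]
  exact ENNReal.ofReal_ne_top

/-- A bound linear in c, from gain ≤ 1; it makes the exponent vanish as c → 0, which gives
finiteness of the interferences. -/
lemma exponent_mul_le {b c : ℝ} (hb : 0 < b) (hc : 0 < c) :
    p.exponent (c * b) ≤ ENNReal.ofReal (c * (1 + b)) * p.exponent b := by
  unfold exponent
  rw [← lintegral_const_mul' _ _ ENNReal.ofReal_ne_top]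
  refine lintegral_mono fun z => ?_
  rw [← ENNReal.ofReal_mul (by positivity)]
  refine ENNReal.ofReal_le_ofReal ?_
  have h0 := p.gain_nonneg z
  have h1 := p.gain_le_one z
  rw [mul_div_assoc', div_le_div_iff₀ (by positivity) (by positivity)]
  have h2 : 0 ≤ c * b * p.gain z := by positivity
  have h3 : 1 + b * p.gain z ≤ (1 + b) * (1 + c * b * p.gain z) := by
    nlinarith [mul_le_mul_of_nonneg_left h1 hb.le, mul_nonneg hb.le h2]
  nlinarith [mul_le_mul_of_nonneg_left h3 h2]

lemma laplaceForm_eq {lam P s : ℝ} (hlam : 0 ≤ lam) (hb : 0 < P * s) :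
    p.laplaceForm lam P s =
      (expNeg (ENNReal.ofReal lam * p.exponent (P * s))).toReal := by
  rw [expNeg_toReal (ENNReal.mul_ne_top ENNReal.ofReal_ne_top (p.exponent_ne_top hb)),
    ENNReal.toReal_mul, ENNReal.toReal_ofReal hlam, p.exponent_eq hb, laplaceForm,
    ENNReal.toReal_ofReal]
  · congr 2
    rw [← mul_assoc (2 : ℝ) P s]
    ring
  · have := p.sin_pos
    have := p.TI_pos
    exact mul_nonneg (by positivity) (p.closedForm_nonneg hb)

end Parameters

/-! ### Exponential random variables -/

section Exponential

/-- Tilting the rate 1 density by e^{-ah} gives 1/(1+a) times the density of rate 1+a. -/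
lemma lintegral_expNeg_expMeasure {a : ℝ} (ha : 0 ≤ a) :
    ∫⁻ h, expNeg (ENNReal.ofReal (a * h)) ∂(expMeasure 1) = ENNReal.ofReal (1 / (1 + a)) := by
  have h1 : expMeasure 1 = volume.withDensity (exponentialPDF 1) := rfl
  have hm (r : ℝ) : Measurable (exponentialPDF r) :=
    (measurable_exponentialPDFReal r).ennreal_ofReal
  rw [h1, lintegral_withDensity_eq_lintegral_mul _ (hm 1)
    (g := fun h => expNeg (ENNReal.ofReal (a * h)))
    (measurable_expNeg.comp (measurable_const_mul a).ennreal_ofReal)]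
  have h2 (x : ℝ) : (exponentialPDF 1 * fun h => expNeg (ENNReal.ofReal (a * h))) x =
      ENNReal.ofReal (1 / (1 + a)) * exponentialPDF (1 + a) x := by
    simp only [Pi.mul_apply]
    rcases lt_or_ge x 0 with hx | hx
    · rw [exponentialPDF_of_neg hx, exponentialPDF_of_neg hx, zero_mul, mul_zero]
    · rw [exponentialPDF_of_nonneg hx, exponentialPDF_of_nonneg hx,
        expNeg_ofReal (mul_nonneg ha hx), ← ENNReal.ofReal_mul (by positivity),
        ← ENNReal.ofReal_mul (by positivity)]
      congr 1
      rw [one_mul, ← Real.exp_add]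
      field_simp
      ring_nf
  simp_rw [h2]
  rw [lintegral_const_mul _ (hm _), lintegral_exponentialPDF_eq_one (by linarith), mul_one]

lemma expMeasure_Ici {x : ℝ} (hx : 0 ≤ x) :
    expMeasure 1 (Set.Ici x) = ENNReal.ofReal (Real.exp (-x)) := by
  have h1 : expMeasure 1 = volume.withDensity (exponentialPDF 1) := rfl
  rw [h1, withDensity_apply _ measurableSet_Ici, ← integral_exp_neg_Ioi,
    ofReal_integral_eq_lintegral_ofReal (integrableOn_exp_neg_Ioi x)
      (Eventually.of_forall fun x => (Real.exp_pos _).le), restrict_Ioi_eq_restrict_Ici]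
  refine setLIntegral_congr_fun measurableSet_Ici fun t ht => ?_
  have ht' : x ≤ t := ht
  simp [exponentialPDF_of_nonneg (hx.trans ht')]

lemma expMeasure_le_ofReal (z : ℝ≥0∞) :
    expMeasure 1 {h | z ≤ ENNReal.ofReal h} = expNeg z := by
  have := isProbabilityMeasure_expMeasure (r := 1) one_pos
  -- For z = 0 the event is the whole line rather than a half-line, since `ENNReal.ofReal` truncates
  -- negative numbers.
  rcases eq_or_ne z 0 with rfl | hz0
  · simp
  rcases eq_or_ne z ∞ with rfl | hz
  · simp
  have h1 : {h | z ≤ ENNReal.ofReal h} = Set.Ici z.toReal := by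
    ext h
    have hpos := ENNReal.toReal_pos hz0 hz
    rw [Set.mem_ofPred_eq, Set.mem_Ici]
    conv_lhs => rw [← ENNReal.ofReal_toReal hz]
    rw [ENNReal.ofReal_le_ofReal_iff', or_iff_left hpos.not_ge]
  rw [h1, expMeasure_Ici ENNReal.toReal_nonneg, ← expNeg_ofReal ENNReal.toReal_nonneg,
    ENNReal.ofReal_toReal hz]

variable {Ω : Type*} [MeasurableSpace Ω] {Pr : Measure Ω}

/-- The tail of an exponential random variable at an independent random level. -/
lemma measure_le_ofReal_of_indepFun [IsProbabilityMeasure Pr] {z : Ω → ℝ≥0∞} {g : Ω → ℝ}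
    (hz : Measurable z)
    (hg : Measurable g) (hlaw : Pr.map g = expMeasure 1) (hind : IndepFun z g Pr) :
    Pr {ω | z ω ≤ ENNReal.ofReal (g ω)} = ∫⁻ ω, expNeg (z ω) ∂Pr := by
  have := isProbabilityMeasure_expMeasure (r := 1) one_pos
  have h1 := (indepFun_iff_map_prod_eq_prod_map_map hz.aemeasurable hg.aemeasurable).1 hind
  have hS : MeasurableSet {w : ℝ≥0∞ × ℝ | w.1 ≤ ENNReal.ofReal w.2} :=
    measurableSet_le measurable_fst measurable_snd.ennreal_ofReal
  have h2 : Pr {ω | z ω ≤ ENNReal.ofReal (g ω)} =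
      Pr.map (fun ω => (z ω, g ω)) {w : ℝ≥0∞ × ℝ | w.1 ≤ ENNReal.ofReal w.2} :=
    (Measure.map_apply (hz.prodMk hg) hS).symm
  rw [h2, h1, hlaw, Measure.prod_apply hS, lintegral_map (measurable_measure_prodMk_left hS) hz]
  exact lintegral_congr fun ω => expMeasure_le_ofReal _

end Exponential

/-! ### Independence of functions of disjoint groups of random elements -/

lemma indepFun_of_measurable_iSup {Ω ι β γ : Type*} {mΩ : MeasurableSpace Ω}
    [mβ : MeasurableSpace β] [mγ : MeasurableSpace γ]
    {Pr : Measure Ω} {m : ι → MeasurableSpace Ω} (hle : ∀ i, m i ≤ mΩ) (h : iIndep m Pr)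
    {S T : Set ι} (hST : Disjoint S T) {f : Ω → β} {g : Ω → γ}
    (hf : Measurable[⨆ i ∈ S, m i] f) (hg : Measurable[⨆ i ∈ T, m i] g) : IndepFun f g Pr := by
  rw [IndepFun_iff_Indep]
  exact indep_of_indep_of_le_left
    (indep_of_indep_of_le_right (indep_iSup_of_disjoint hle h hST) hg.comap_le) hf.comap_le

lemma measurable_coord_iSup {Ω ι β : Type*} [MeasurableSpace β] {m : ι → MeasurableSpace Ω}
    {S : Set ι} {i : ι} (hi : i ∈ S) {f : ℕ → Ω → β}
    (hm : m i = MeasurableSpace.comap (fun ω k => f k ω) inferInstance) (k : ℕ) :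
    Measurable[⨆ i ∈ S, m i] (f k) := by
  have h1 : Measurable[m i] fun ω k => f k ω := by
    rw [hm]
    exact comap_measurable _
  have h2 : Measurable[m i] (f k) := (measurable_pi_apply k).comp h1
  exact h2.mono (le_iSup₂ (f := fun i (_ : i ∈ S) => m i) i hi) le_rfl

/-! ### Interference and energy as sums over points -/

namespace Parameters

variable (p : Parameters)

lemma phi_eq_indicator (t u : ℝ) : p.phi t u = (Set.Icc u (u + p.TI)).indicator 1 t := by
  simp only [phi, Set.indicator_apply, Set.mem_Icc, Pi.one_apply]

/-- The last factor is the length of [0, T] ∩ [u, u+T_I]; `ENNReal.ofReal` makes it 0 when they are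
disjoint. -/
lemma lintegral_phi (T P u h l : ℝ) :
    ∫⁻ t in Set.Icc 0 T, ENNReal.ofReal (P * p.phi t u * h * l) =
      ENNReal.ofReal (P * h * l) * ENNReal.ofReal (min T (u + p.TI) - max 0 u) := by
  have h1 (t : ℝ) : ENNReal.ofReal (P * p.phi t u * h * l) =
      (Set.Icc u (u + p.TI)).indicator (fun _ => ENNReal.ofReal (P * h * l)) t := by
    by_cases ht : t ∈ Set.Icc u (u + p.TI) <;> simp [phi_eq_indicator, ht]
  simp_rw [h1]
  rw [lintegral_indicator_const measurableSet_Icc, Measure.restrict_apply measurableSet_Icc,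
    Set.Icc_inter_Icc, Real.volume_Icc, inf_comm, sup_comm]

lemma measurable_ofReal_phi (P u h l : ℝ) :
    Measurable fun t => ENNReal.ofReal (P * p.phi t u * h * l) := by
  have : Measurable fun t => p.phi t u := by
    simp_rw [phi_eq_indicator]
    exact measurable_one.indicator measurableSet_Icc
  fun_prop

lemma lintegral_phi_div (P h : ℝ) (z : Plane × ℝ) :
    (∫⁻ t in Set.Icc 0 p.TI, ENNReal.ofReal (P * p.phi t z.2 * h * p.pathLoss ‖z.1‖)) /
      ENNReal.ofReal p.TI = ENNReal.ofReal (P * p.gain z * h) := by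
  have hT := p.TI_pos
  have h1 : ENNReal.ofReal (min p.TI (z.2 + p.TI) - max 0 z.2) =
      ENNReal.ofReal (overlap p.TI z.2) * ENNReal.ofReal p.TI := by
    rw [← ENNReal.ofReal_mul (overlap_nonneg _ _), overlap, max_mul_of_nonneg _ _ hT.le, zero_mul,
      sub_mul, div_mul_cancel₀ _ hT.ne', one_mul, ENNReal.ofReal_max, ENNReal.ofReal_zero,
      max_eq_right (zero_le (a := ENNReal.ofReal _))]
    congr 1
    rcases le_total 0 z.2 with h | h
    · rw [abs_of_nonneg h, max_eq_right h, min_eq_left (by linarith)]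
    · rw [abs_of_nonpos h, max_eq_left h, min_eq_right (by linarith)]
      ring
  rw [lintegral_phi, h1, ← mul_assoc, ENNReal.mul_div_cancel_right
    (by simpa using hT) ENNReal.ofReal_ne_top, mul_comm,
    ← ENNReal.ofReal_mul (overlap_nonneg _ _), gain]
  congr 1
  ring

end Parameters

namespace Network

variable {Ω : Type*} (N : Network Ω) (p : Parameters)

lemma I1_eq (ω : Ω) : N.I1 p ω = ∑' i, ENNReal.ofReal (p.P1 * p.gain (N.X i ω) * N.h i ω) := by
  unfold I1 I1at
  rw [lintegral_tsum fun i => (p.measurable_ofReal_phi _ _ _ _).aemeasurable, div_eq_mul_inv,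
    ← ENNReal.tsum_mul_right]
  simp_rw [← div_eq_mul_inv, p.lintegral_phi_div]

lemma energy_eq (ω : Ω) : N.energy p ω = ∑' i,
    ENNReal.ofReal (p.P1 * N.h i ω * p.pathLoss ‖(N.X i ω).1‖) *
      ENNReal.ofReal (min p.TE ((N.X i ω).2 + p.TI) - max 0 (N.X i ω).2) := by
  unfold energy harvestPower
  rw [lintegral_tsum fun i => (p.measurable_ofReal_phi _ _ _ _).aemeasurable]
  simp_rw [p.lintegral_phi]

lemma I2_eq [MeasurableSpace Ω] (Pr : Measure Ω) (ω : Ω) : N.I2 p Pr ω = ∑' j,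
    if N.keep j ω = true then ENNReal.ofReal (N.P2 p Pr * p.gain (N.Y j ω) * N.g j ω) else 0 := by
  unfold I2 I2at
  rw [lintegral_tsum, div_eq_mul_inv, ← ENNReal.tsum_mul_right]
  · refine tsum_congr fun j => ?_
    by_cases hk : N.keep j ω = true
    · simp only [hk, if_true]
      rw [← div_eq_mul_inv, p.lintegral_phi_div]
    · simp [hk]
  · intro j
    by_cases hk : N.keep j ω = true
    · simpa only [hk, if_true] using (p.measurable_ofReal_phi _ _ _ _).aemeasurable
    · simp [hk]

end Network

lemma Parameters.measurable_primary_sum (p : Parameters) (P : ℝ) {Ω : Type*} [MeasurableSpace Ω]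
    {X : ℕ → Ω → Plane × ℝ}
    {h : ℕ → Ω → ℝ} (hX : ∀ i, Measurable (X i)) (hh : ∀ i, Measurable (h i)) :
    Measurable fun ω => ∑' i, ENNReal.ofReal (P * p.gain (X i ω) * h i ω) :=
  Measurable.tsum fun i =>
    (((p.measurable_gain.comp (hX i)).const_mul P).mul (hh i)).ennreal_ofReal

lemma Parameters.measurable_secondary_sum (p : Parameters) (P : ℝ) {Ω : Type*} [MeasurableSpace Ω]
    {Y : ℕ → Ω → Plane × ℝ} {g : ℕ → Ω → ℝ} {keep : ℕ → Ω → Bool} (hY : ∀ i, Measurable (Y i))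
    (hg : ∀ i, Measurable (g i)) (hk : ∀ i, Measurable (keep i)) :
    Measurable fun ω => ∑' j,
      if keep j ω = true then ENNReal.ofReal (P * p.gain (Y j ω) * g j ω) else 0 :=
  Measurable.tsum fun j => Measurable.ite (hk j (measurableSet_singleton true))
    (((p.measurable_gain.comp (hY j)).const_mul P).mul (hg j)).ennreal_ofReal measurable_const

/-- The σ-algebras generated by the random elements of the two networks. -/
@[reducible] def Network.sigmaAlgebra {Ω : Type*} (N : Network Ω) : Fin 7 → MeasurableSpace Ω :=
  ![MeasurableSpace.comap (fun ω i => N.X i ω) inferInstance,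
    MeasurableSpace.comap (fun ω i => N.h i ω) inferInstance,
    MeasurableSpace.comap (fun ω i => N.e i ω) inferInstance,
    MeasurableSpace.comap (fun ω j => N.Y j ω) inferInstance,
    MeasurableSpace.comap (fun ω j => N.g j ω) inferInstance,
    MeasurableSpace.comap (fun ω j => N.keep j ω) inferInstance,
    MeasurableSpace.comap N.g0 inferInstance]

lemma Network.measurable_I1_iSup {Ω : Type*} (N : Network Ω) (p : Parameters) {S : Set (Fin 7)}
    (hX : 0 ∈ S) (hh : 1 ∈ S) : Measurable[⨆ i ∈ S, N.sigmaAlgebra i] (N.I1 p) := by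
  have h1 : N.I1 p = _ := funext (N.I1_eq p)
  rw [h1]
  -- The σ-algebra on Ω is here the supremum over S, not the ambient instance.
  exact @Parameters.measurable_primary_sum _ _ _ (_) _ _
    (measurable_coord_iSup hX rfl) (measurable_coord_iSup hh rfl)

lemma Network.measurable_I2_iSup {Ω : Type*} (N : Network Ω) (p : Parameters)
    [MeasurableSpace Ω] (Pr : Measure Ω) {S : Set (Fin 7)}
    (hY : 3 ∈ S) (hg : 4 ∈ S) (hk : 5 ∈ S) :
    Measurable[⨆ i ∈ S, N.sigmaAlgebra i] (N.I2 p Pr) := by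
  have h1 : N.I2 p Pr = _ := funext (N.I2_eq p Pr)
  rw [h1]
  exact @Parameters.measurable_secondary_sum _ _ _ (_) _ _ _
    (measurable_coord_iSup hY rfl) (measurable_coord_iSup hg rfl) (measurable_coord_iSup hk rfl)

lemma sigmaFinite_ofReal_smul {E : Type*} [MeasurableSpace E] (r : ℝ) (μ : Measure E)
    [SigmaFinite μ] : SigmaFinite (ENNReal.ofReal r • μ) :=
  ⟨⟨{ set := spanningSets μ
      set_mem := fun _ => trivial
      finite := fun n => by
        rw [Measure.smul_apply, smul_eq_mul]
        exact ENNReal.mul_lt_top ENNReal.ofReal_lt_top (measure_spanningSets_lt_top μ n)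
      spanning := iUnion_spanningSets μ }⟩⟩

/-! ### Laplace transforms of the two interferences -/

namespace Network.IsModel

section

variable {Ω : Type*} [MeasurableSpace Ω] {Pr : Measure Ω} {p : Parameters} {N : Network Ω}

lemma sigmaAlgebra_le (hN : N.IsModel p Pr) (i : Fin 7) :
    N.sigmaAlgebra i ≤ (inferInstance : MeasurableSpace Ω) := by
  have h1 : Measurable fun ω i => N.X i ω := measurable_pi_iff.2 hN.primary.measurable
  have h2 : Measurable fun ω i => N.h i ω := measurable_pi_iff.2 hN.measurable_h
  have h3 : Measurable fun ω i => N.e i ω := measurable_pi_iff.2 hN.measurable_e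
  have h4 : Measurable fun ω i => N.Y i ω := measurable_pi_iff.2 hN.secondary.measurable
  have h5 : Measurable fun ω i => N.g i ω := measurable_pi_iff.2 hN.measurable_g
  have h6 : Measurable fun ω i => N.keep i ω := measurable_pi_iff.2 hN.measurable_keep
  fin_cases i
  exacts [h1.comap_le, h2.comap_le, h3.comap_le, h4.comap_le, h5.comap_le, h6.comap_le,
    hN.measurable_g0.comap_le]

lemma iIndep_sigmaAlgebra (hN : N.IsModel p Pr) : iIndep N.sigmaAlgebra Pr := hN.indep

lemma indepFun_X_h (hN : N.IsModel p Pr) :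
    IndepFun (fun ω i => N.X i ω) (fun ω i => N.h i ω) Pr :=
  hN.indep.indep (show (0 : Fin 7) ≠ 1 by decide)

lemma indepFun_Y_g (hN : N.IsModel p Pr) :
    IndepFun (fun ω i => N.Y i ω) (fun ω i => N.g i ω) Pr :=
  hN.indep.indep (show (3 : Fin 7) ≠ 4 by decide)

lemma indepFun_Yg_keep (hN : N.IsModel p Pr) :
    IndepFun (fun ω i => (N.Y i ω, N.g i ω)) (fun ω i => N.keep i ω) Pr := by
  refine indepFun_of_measurable_iSup hN.sigmaAlgebra_le hN.iIndep_sigmaAlgebra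
    (S := {3, 4}) (T := {5}) (by simp) ?_ ?_
  · refine @measurable_pi_lambda _ _ _ (_) _ _ fun i => Measurable.prodMk ?_ ?_
    · exact measurable_coord_iSup (i := 3) (by simp) rfl i
    · exact measurable_coord_iSup (i := 4) (by simp) rfl i
  · refine @measurable_pi_lambda _ _ _ (_) _ _ fun i => ?_
    exact measurable_coord_iSup (i := 5) (by simp) rfl i

lemma measurable_I1 (hN : N.IsModel p Pr) : Measurable (N.I1 p) :=
  (N.measurable_I1_iSup p (S := Set.univ) trivial trivial).mono
    (iSup₂_le fun i _ => hN.sigmaAlgebra_le i) le_rfl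

lemma measurable_I2 (hN : N.IsModel p Pr) : Measurable (N.I2 p Pr) :=
  (N.measurable_I2_iSup p Pr (S := Set.univ) trivial trivial trivial).mono
    (iSup₂_le fun i _ => hN.sigmaAlgebra_le i) le_rfl

lemma indepFun_I1_I2 (hN : N.IsModel p Pr) : IndepFun (N.I1 p) (N.I2 p Pr) Pr :=
  indepFun_of_measurable_iSup hN.sigmaAlgebra_le hN.iIndep_sigmaAlgebra
    (S := {0, 1}) (T := {3, 4, 5}) (by simp [Set.disjoint_left])
    (N.measurable_I1_iSup p (by simp) (by simp))
    (N.measurable_I2_iSup p Pr (by simp) (by simp) (by simp))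

lemma indepFun_interference_g0 (hN : N.IsModel p Pr) :
    IndepFun (fun ω => N.I1 p ω + N.I2 p Pr ω) N.g0 Pr :=
  indepFun_of_measurable_iSup hN.sigmaAlgebra_le hN.iIndep_sigmaAlgebra
    (S := {0, 1, 3, 4, 5}) (T := {6}) (by simp)
    (Measurable.add (N.measurable_I1_iSup p (by simp) (by simp))
      (N.measurable_I2_iSup p Pr (by simp) (by simp) (by simp)))
    ((comap_measurable N.g0).mono
      (le_iSup₂ (f := fun i (_ : i ∈ ({6} : Set (Fin 7))) => N.sigmaAlgebra i) 6 rfl) le_rfl)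

lemma transmitProb_nonneg (hN : N.IsModel p Pr) : 0 ≤ N.transmitProb p Pr := by
  rw [← hN.law_keep 0]
  exact measureReal_nonneg

end

variable {Ω : Type*} [MeasurableSpace Ω] {Pr : Measure Ω} [IsProbabilityMeasure Pr]
  {p : Parameters} {N : Network Ω}

lemma transmitProb_le_one (hN : N.IsModel p Pr) : N.transmitProb p Pr ≤ 1 := by
  rw [← hN.law_keep 0]
  exact measureReal_le_one

lemma map_keep_true (hN : N.IsModel p Pr) (j : ℕ) :
    Pr.map (N.keep j) {true} = ENNReal.ofReal (N.transmitProb p Pr) := by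
  rw [Measure.map_apply (hN.measurable_keep j) (measurableSet_singleton _), ← hN.law_keep j,
    ofReal_measureReal]
  rfl

lemma map_keep_false (hN : N.IsModel p Pr) (j : ℕ) :
    Pr.map (N.keep j) {false} = ENNReal.ofReal (1 - N.transmitProb p Pr) := by
  have := Measure.isProbabilityMeasure_map (μ := Pr) (hN.measurable_keep j).aemeasurable
  have h1 : ({false} : Set Bool) = {true}ᶜ := by
    ext b
    cases b <;> simp
  rw [h1, prob_compl_eq_one_sub (measurableSet_singleton _), hN.map_keep_true,
    ENNReal.ofReal_sub _ hN.transmitProb_nonneg, ENNReal.ofReal_one]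

lemma map_keep_eq (hN : N.IsModel p Pr) (j : ℕ) : Pr.map (N.keep j) = Pr.map (N.keep 0) := by
  refine Measure.ext_of_singleton fun b => ?_
  cases b
  · rw [hN.map_keep_false, hN.map_keep_false]
  · rw [hN.map_keep_true, hN.map_keep_true]

lemma one_sub_ofReal_one_div {a : ℝ} (ha : 0 ≤ a) :
    1 - ENNReal.ofReal (1 / (1 + a)) = ENNReal.ofReal (a / (1 + a)) := by
  rw [← ENNReal.ofReal_one, ← ENNReal.ofReal_sub _ (by positivity)]
  congr 1
  field_simp
  ring

theorem lintegral_expNeg_I1 (hN : N.IsModel p Pr) {c : ℝ} (hc : 0 < c) :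
    ∫⁻ ω, expNeg (ENNReal.ofReal c * N.I1 p ω) ∂Pr =
      expNeg (ENNReal.ofReal p.lam1 * p.exponent (p.P1 * c)) := by
  have := isProbabilityMeasure_expMeasure (r := 1) one_pos
  have := sigmaFinite_ofReal_smul p.lam1 (volume : Measure (Plane × ℝ))
  have hb : 0 ≤ p.P1 * c := (mul_pos p.P1_pos hc).le
  have hgain (z) : 0 ≤ p.P1 * c * p.gain z := mul_nonneg hb (p.gain_nonneg z)
  have h1 (ω) : ENNReal.ofReal c * N.I1 p ω =
      ∑' i, ENNReal.ofReal (p.P1 * c * p.gain (N.X i ω) * N.h i ω) := by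
    rw [N.I1_eq, ← ENNReal.tsum_mul_left]
    refine tsum_congr fun i => ?_
    rw [← ENNReal.ofReal_mul hc.le]
    ring_nf
  have hf : Measurable fun w : (Plane × ℝ) × ℝ =>
      ENNReal.ofReal (p.P1 * c * p.gain w.1 * w.2) :=
    (((p.measurable_gain.comp measurable_fst).const_mul _).mul measurable_snd).ennreal_ofReal
  have hψ : Measurable fun z => ENNReal.ofReal (1 / (1 + p.P1 * c * p.gain z)) :=
    (measurable_const.div ((p.measurable_gain.const_mul _).const_add 1)).ennreal_ofReal
  simp_rw [h1]
  rw [laplace_marks hN.primary.measurable hN.measurable_h hN.law_h hN.indep_h hN.indepFun_X_h hf]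
  simp_rw [lintegral_expNeg_expMeasure (hgain _)]
  rw [hN.primary.laplace_functional
    (u := fun z => negLog (ENNReal.ofReal (1 / (1 + p.P1 * c * p.gain z))))
    (measurable_negLog.comp hψ), lintegral_smul_measure,
    smul_eq_mul, Parameters.exponent]
  congr 2
  refine lintegral_congr fun z => ?_
  rw [expNeg_negLog, one_sub_ofReal_one_div (hgain z)]
  rw [← ENNReal.ofReal_one]
  refine ENNReal.ofReal_le_ofReal ((div_le_one ?_).2 ?_) <;> linarith [hgain z]

/-- Retention and fading are integrated out in turn, leaving 1 - πx with x = b·gain/(1+b·gain).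
Since 1 - (1 - πx) = πx, thinning amounts to multiplying the density by π. -/
theorem lintegral_expNeg_I2 (hN : N.IsModel p Pr) (hP : 0 < N.P2 p Pr) {c : ℝ} (hc : 0 < c) :
    ∫⁻ ω, expNeg (ENNReal.ofReal c * N.I2 p Pr ω) ∂Pr =
      expNeg (ENNReal.ofReal (p.lam2 * N.transmitProb p Pr) * p.exponent (N.P2 p Pr * c)) := by
  have := isProbabilityMeasure_expMeasure (r := 1) one_pos
  have := sigmaFinite_ofReal_smul p.lam2 (volume : Measure (Plane × ℝ))
  have := Measure.isProbabilityMeasure_map (μ := Pr) (hN.measurable_keep 0).aemeasurable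
  set b : ℝ := N.P2 p Pr * c with hbdef
  have hb : 0 ≤ b := (mul_pos hP hc).le
  set π : ℝ := N.transmitProb p Pr with hπdef
  have hπ0 : 0 ≤ π := hN.transmitProb_nonneg
  have hπ1 : π ≤ 1 := hN.transmitProb_le_one
  have hgain (z) : 0 ≤ b * p.gain z := mul_nonneg hb (p.gain_nonneg z)
  let f : ((Plane × ℝ) × ℝ) × Bool → ℝ≥0∞ := fun w =>
    if w.2 = true then ENNReal.ofReal (b * p.gain w.1.1 * w.1.2) else 0
  have h1 (ω) : ENNReal.ofReal c * N.I2 p Pr ω =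
      ∑' i, f ((N.Y i ω, N.g i ω), N.keep i ω) := by
    rw [N.I2_eq, ← ENNReal.tsum_mul_left]
    refine tsum_congr fun i => ?_
    simp only [f, mul_ite, mul_zero]
    rw [← ENNReal.ofReal_mul hc.le, hbdef]
    ring_nf
  have hg : Measurable fun w : (Plane × ℝ) × ℝ => ENNReal.ofReal (b * p.gain w.1 * w.2) :=
    (((p.measurable_gain.comp measurable_fst).const_mul _).mul measurable_snd).ennreal_ofReal
  have hf : Measurable f := Measurable.ite
    (measurable_snd (measurableSet_singleton true)) (hg.comp measurable_fst) measurable_const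
  have hψ1 (w : (Plane × ℝ) × ℝ) : ∫⁻ k, expNeg (f (w, k)) ∂(Pr.map (N.keep 0)) =
      expNeg (ENNReal.ofReal (b * p.gain w.1 * w.2)) * ENNReal.ofReal π +
        ENNReal.ofReal (1 - π) := by
    rw [lintegral_fintype, Fintype.sum_bool, hN.map_keep_true, hN.map_keep_false, ← hπdef]
    simp [f]
  have hψ1m : Measurable fun w : (Plane × ℝ) × ℝ =>
      expNeg (ENNReal.ofReal (b * p.gain w.1 * w.2)) * ENNReal.ofReal π +
        ENNReal.ofReal (1 - π) :=
    ((measurable_expNeg.comp hg).mul_const _).add_const _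
  have hsum : ENNReal.ofReal π + ENNReal.ofReal (1 - π) = 1 := by
    rw [← ENNReal.ofReal_add hπ0 (by linarith)]
    simp
  have hψ1le (w : (Plane × ℝ) × ℝ) :
      expNeg (ENNReal.ofReal (b * p.gain w.1 * w.2)) * ENNReal.ofReal π +
        ENNReal.ofReal (1 - π) ≤ 1 := by
    rw [← hsum]
    gcongr
    exact mul_le_of_le_one_left zero_le (expNeg_le_one _)
  have hψ2 (z : Plane × ℝ) : ∫⁻ h, (expNeg (ENNReal.ofReal (b * p.gain z * h)) *
      ENNReal.ofReal π + ENNReal.ofReal (1 - π)) ∂(expMeasure 1) =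
      ENNReal.ofReal (1 - π * (b * p.gain z / (1 + b * p.gain z))) := by
    rw [lintegral_add_right _ measurable_const, lintegral_mul_const' _ _ ENNReal.ofReal_ne_top,
      lintegral_expNeg_expMeasure (hgain z), lintegral_const, measure_univ, mul_one,
      ← ENNReal.ofReal_mul (by have := hgain z; positivity),
      ← ENNReal.ofReal_add (by have := hgain z; positivity) (by linarith)]
    congr 1
    have := hgain z
    field_simp
    ring
  have hψ2m : Measurable fun z =>
      ENNReal.ofReal (1 - π * (b * p.gain z / (1 + b * p.gain z))) :=
    (measurable_const.sub (((p.measurable_gain.const_mul b).div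
      ((p.measurable_gain.const_mul b).const_add 1)).const_mul π)).ennreal_ofReal
  simp_rw [h1]
  -- The "points" are first the pairs of location-time and fading, marked by retention; these need
  -- not form a Poisson process at this stage.
  rw [laplace_marks (X := fun i ω => (N.Y i ω, N.g i ω))
    (fun i => (hN.secondary.measurable i).prodMk (hN.measurable_g i)) hN.measurable_keep
    hN.map_keep_eq hN.indep_keep hN.indepFun_Yg_keep hf]
  simp_rw [hψ1]
  rw [laplace_marks hN.secondary.measurable hN.measurable_g hN.law_g hN.indep_g hN.indepFun_Y_g
    (f := fun w => negLog (expNeg (ENNReal.ofReal (b * p.gain w.1 * w.2)) * ENNReal.ofReal π +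
        ENNReal.ofReal (1 - π))) (measurable_negLog.comp hψ1m)]
  simp_rw [expNeg_negLog (hψ1le (_, _)), hψ2]
  rw [hN.secondary.laplace_functional
    (u := fun z => negLog (ENNReal.ofReal (1 - π * (b * p.gain z / (1 + b * p.gain z)))))
    (measurable_negLog.comp hψ2m), lintegral_smul_measure,
    smul_eq_mul, Parameters.exponent, ENNReal.ofReal_mul p.lam2_pos.le, mul_assoc,
    ← lintegral_const_mul' (ENNReal.ofReal π) _ ENNReal.ofReal_ne_top]
  congr 2
  refine lintegral_congr fun z => ?_
  have h0 : 0 ≤ b * p.gain z / (1 + b * p.gain z) := by have := hgain z; positivity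
  have h1 : b * p.gain z / (1 + b * p.gain z) ≤ 1 :=
    (div_le_one (by linarith [hgain z])).2 (by linarith)
  have h2 : π * (b * p.gain z / (1 + b * p.gain z)) ≤ 1 := mul_le_one₀ hπ1 h0 h1
  rw [expNeg_negLog, ← ENNReal.ofReal_mul hπ0, ← ENNReal.ofReal_one,
    ← ENNReal.ofReal_sub _ (by linarith)]
  · simp
  · rw [← ENNReal.ofReal_one]
    exact ENNReal.ofReal_le_ofReal (by linarith [mul_nonneg hπ0 h0])

end Network.IsModel

/-! ### Almost sure finiteness of the interferences -/

/-- A shot noise whose Laplace transform is governed by `exponent` is almost surely finite. -/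
lemma ae_lt_top_of_lintegral_expNeg {Ω : Type*} [MeasurableSpace Ω] {Pr : Measure Ω}
    [IsProbabilityMeasure Pr] (p : Parameters) {I : Ω → ℝ≥0∞} (hI : Measurable I) {κ : ℝ≥0∞}
    (hκ : κ ≠ ∞) {P : ℝ} (hP : 0 < P)
    (h : ∀ c : ℝ, 0 < c → ∫⁻ ω, expNeg (ENNReal.ofReal c * I ω) ∂Pr =
      expNeg (κ * p.exponent (P * c))) : ∀ᵐ ω ∂Pr, I ω < ∞ := by
  have hS : MeasurableSet {ω | I ω < ∞} := measurableSet_lt hI measurable_const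
  -- For every c > 0, e^{-cI} vanishes where I = ∞, so P(I = ∞) ≤ 1 - E e^{-cI}, which is at most
  -- the exponent and hence O(c).
  have hbound (c : ℝ) (hc : 0 < c) :
      Pr {ω | I ω < ∞}ᶜ ≤ ENNReal.ofReal (c * (1 + P)) * (κ * p.exponent P) := by
    have h1 : ∫⁻ ω, expNeg (ENNReal.ofReal c * I ω) ∂Pr ≤ Pr {ω | I ω < ∞} := by
      rw [← lintegral_indicator_one hS]
      refine lintegral_mono fun ω => ?_
      by_cases hω : I ω < ∞
      · rw [Set.indicator_of_mem (show ω ∈ {ω | I ω < ∞} from hω)]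
        exact expNeg_le_one _
      · have : I ω = ∞ := not_lt_top_iff.1 hω
        simp [this, ENNReal.mul_top, hc]
    rw [prob_compl_eq_one_sub hS]
    refine (tsub_le_tsub_left h1 1).trans ?_
    rw [h c hc, tsub_le_iff_left]
    have h2 := tsub_le_iff_left.1 (one_sub_le_expNeg (κ * p.exponent (P * c)))
    rw [add_comm]
    refine h2.trans (add_le_add_left ?_ _)
    rw [mul_left_comm, mul_comm P]
    gcongr
    exact p.exponent_mul_le hP hc
  have hlim : Tendsto (fun c : ℝ => ENNReal.ofReal (c * (1 + P)) * (κ * p.exponent P))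
      (𝓝[>] 0) (𝓝 0) := by
    have h1 : Tendsto (fun c : ℝ => ENNReal.ofReal (c * (1 + P)) * (κ * p.exponent P))
        (𝓝 0) (𝓝 (ENNReal.ofReal (0 * (1 + P)) * (κ * p.exponent P))) :=
      ENNReal.Tendsto.mul_const ((ENNReal.continuous_ofReal.comp
        (continuous_mul_const (1 + P))).tendsto 0)
        (Or.inr (ENNReal.mul_ne_top hκ (p.exponent_ne_top hP)))
    simpa using h1.mono_left nhdsWithin_le_nhds
  have : Pr {ω | I ω < ∞}ᶜ ≤ 0 := ge_of_tendsto hlim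
    (eventually_nhdsWithin_of_forall fun c hc => hbound c hc)
  exact nonpos_iff_eq_zero.1 this

/-! ### Positivity of the average secondary power -/

namespace Network.IsModel

section

variable {Ω : Type*} [MeasurableSpace Ω] {Pr : Measure Ω} {p : Parameters} {N : Network Ω}

lemma measurable_energy (hN : N.IsModel p Pr) : Measurable (N.energy p) := by
  have h1 : N.energy p = _ := funext (N.energy_eq p)
  rw [h1]
  refine Measurable.tsum fun i => ?_
  have hX := hN.primary.measurable i
  have hh := hN.measurable_h i
  unfold Parameters.pathLoss
  fun_prop

lemma ae_g0_pos (hN : N.IsModel p Pr) : ∀ᵐ ω ∂Pr, 0 < N.g0 ω := by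
  have h1 := isProbabilityMeasure_expMeasure (r := 1) one_pos
  have h2 : ∀ᵐ x ∂(expMeasure 1), 0 < x := by
    have h3 : expMeasure 1 (Set.Iic 0) = 0 := by
      rw [← ofReal_cdf, cdf_expMeasure_eq one_pos]
      simp
    exact (measure_eq_zero_iff_ae_notMem.1 h3).mono fun x hx => not_le.1 hx
  rw [← hN.law_g0] at h2
  exact ae_of_ae_map hN.measurable_g0.aemeasurable h2

end

variable {Ω : Type*} [MeasurableSpace Ω] {Pr : Measure Ω} [IsProbabilityMeasure Pr]
  {p : Parameters} {N : Network Ω}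

/-- The harvested energy exceeds every level with positive probability. -/
lemma measure_le_energy_pos (hN : N.IsModel p Pr) {M : ℝ} (hM : 0 ≤ M) :
    0 < Pr {ω | ENNReal.ofReal M ≤ N.energy p ω} := by
  have hTI := p.TI_pos
  have hTE := p.TE_pos
  have hP1 := p.P1_pos
  have hlam := p.lam1_pos
  -- A transmitter in A has path loss at least 1/2 and is active for at least τ = min(T_I, T_E/2) of
  -- the harvesting phase.
  set A : Set (Plane × ℝ) := Metric.ball 0 1 ×ˢ Set.Icc 0 (p.TE / 2)
  have hA : MeasurableSet A := measurableSet_ball.prod measurableSet_Icc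
  have hvol : (volume : Measure (Plane × ℝ)) A =
      volume (Metric.ball (0 : Plane) 1) * ENNReal.ofReal (p.TE / 2) := by
    rw [Measure.volume_eq_prod, Measure.prod_prod, Real.volume_Icc, sub_zero]
  obtain ⟨i, hi⟩ := hN.primary.exists_measure_preimage_pos hA
    (by
      rw [Measure.smul_apply, smul_eq_mul, hvol]
      exact ENNReal.mul_lt_top ENNReal.ofReal_lt_top
        (ENNReal.mul_lt_top measure_ball_lt_top ENNReal.ofReal_lt_top))
    (by
      rw [Measure.smul_apply, smul_eq_mul, hvol]
      exact ENNReal.mul_pos (by simpa using hlam)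
        (mul_ne_zero (Metric.measure_ball_pos _ _ one_pos).ne' (by simpa using hTE)))
  set τ : ℝ := min p.TI (p.TE / 2)
  have hτ : 0 < τ := lt_min hTI (by linarith)
  -- Fading at least B gives energy at least P₁·B·(1/2)·τ = M from this transmitter alone.
  set B : ℝ := 2 * M / (p.P1 * τ)
  have hB : 0 ≤ B := by positivity
  have hind : IndepFun (N.X i) (N.h i) Pr :=
    hN.indepFun_X_h.comp (measurable_pi_apply i) (measurable_pi_apply i)
  have hpos : 0 < Pr (N.X i ⁻¹' A ∩ N.h i ⁻¹' Set.Ici B) := by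
    rw [hind.measure_inter_preimage_eq_mul _ _ hA measurableSet_Ici]
    refine ENNReal.mul_pos hi.ne' ?_
    rw [← Measure.map_apply (hN.measurable_h i) measurableSet_Ici, hN.law_h i, expMeasure_Ici hB]
    simpa using Real.exp_pos _
  refine hpos.trans_le (measure_mono fun ω hω => ?_)
  obtain ⟨⟨hx, hu0, hu1⟩, hh⟩ := hω
  have hh' : B ≤ N.h i ω := hh
  have hx' : ‖(N.X i ω).1‖ ≤ 1 := (mem_ball_zero_iff.1 hx).le
  have hl : 1 / 2 ≤ p.pathLoss ‖(N.X i ω).1‖ := by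
    have h1 : ‖(N.X i ω).1‖ ^ p.α ≤ 1 :=
      Real.rpow_le_one (norm_nonneg _) hx' (by linarith [p.two_lt_α])
    have h2 : 0 ≤ ‖(N.X i ω).1‖ ^ p.α := by positivity
    rw [Parameters.pathLoss, one_div]
    exact inv_anti₀ (by linarith) (by linarith)
  have hτ' : τ ≤ min p.TE ((N.X i ω).2 + p.TI) - max 0 (N.X i ω).2 := by
    rw [max_eq_right hu0, le_sub_iff_add_le]
    refine le_min ?_ ?_
    · linarith [min_le_right p.TI (p.TE / 2)]
    · linarith [min_le_left p.TI (p.TE / 2)]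
  rw [Set.mem_ofPred_eq, N.energy_eq]
  refine le_trans ?_ (ENNReal.le_tsum i)
  rw [← ENNReal.ofReal_mul (by
    have := hB.trans hh'
    have : 0 ≤ p.pathLoss ‖(N.X i ω).1‖ := by linarith
    positivity)]
  refine ENNReal.ofReal_le_ofReal ?_
  calc M = p.P1 * B * (1 / 2) * τ := by
        simp only [B]
        field_simp
    _ ≤ _ := by
        have := hB.trans hh'
        have : 0 ≤ p.pathLoss ‖(N.X i ω).1‖ := by linarith
        gcongr

theorem P2_pos (hN : N.IsModel p Pr) : 0 < N.P2 p Pr := by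
  have hsat : 0 < p.sat / p.TI := div_pos p.sat_pos p.TI_pos
  -- Only c ≥ 0 matters, which holds even if the mean were infinite and `toReal` returned 0:
  -- positivity comes from the saturated branch.
  set c : ℝ := (∫⁻ ω', N.energy p ω' ∂Pr).toReal / p.TI with hc
  have hc0 : 0 ≤ c := div_nonneg ENNReal.toReal_nonneg p.TI_pos.le
  have hE := hN.measurable_energy
  have hmeas : Measurable (N.power p Pr) := by
    unfold power
    exact Measurable.ite (measurableSet_lt hE measurable_const) measurable_const
      (Measurable.ite (measurableSet_lt hE measurable_const) measurable_const measurable_const)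
  have h0 (ω) : 0 ≤ N.power p Pr ω := by
    unfold power
    split_ifs
    exacts [le_rfl, hc0, hsat.le]
  have hle (ω) : N.power p Pr ω ≤ c + p.sat / p.TI := by
    unfold power
    split_ifs <;> linarith
  have hint : Integrable (N.power p Pr) Pr :=
    Integrable.of_bound hmeas.aestronglyMeasurable (c + p.sat / p.TI)
      (Eventually.of_forall fun ω => by rw [Real.norm_of_nonneg (h0 ω)]; exact hle ω)
  refine (integral_pos_iff_support_of_nonneg h0 hint).2 ?_
  refine (hN.measure_le_energy_pos p.sat_pos.le).trans_le (measure_mono fun ω hω => ?_)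
  have hω1 : ENNReal.ofReal p.sat ≤ N.energy p ω := hω
  have hω2 : ENNReal.ofReal p.ε ≤ N.energy p ω :=
    (ENNReal.ofReal_le_ofReal p.ε_le_sat).trans hω1
  rw [Function.mem_support]
  unfold power
  rw [if_neg hω2.not_gt, if_neg hω1.not_gt]
  exact hsat.ne'

lemma ae_I1_lt_top (hN : N.IsModel p Pr) : ∀ᵐ ω ∂Pr, N.I1 p ω < ∞ :=
  ae_lt_top_of_lintegral_expNeg p hN.measurable_I1 ENNReal.ofReal_ne_top p.P1_pos
    fun _ hc => hN.lintegral_expNeg_I1 hc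

lemma ae_I2_lt_top (hN : N.IsModel p Pr) : ∀ᵐ ω ∂Pr, N.I2 p Pr ω < ∞ :=
  ae_lt_top_of_lintegral_expNeg p hN.measurable_I2 ENNReal.ofReal_ne_top hN.P2_pos
    fun _ hc => hN.lintegral_expNeg_I2 hN.P2_pos hc

end Network.IsModel

/-! ### Coverage probability -/

/-- Finiteness is essential: where I = ∞ and s > 0, `toReal` would make the left integrand 1 while
the right one is 0. -/
lemma integral_exp_neg_mul_toReal {Ω : Type*} [MeasurableSpace Ω] {Pr : Measure Ω}
    {I : Ω → ℝ≥0∞} (hI : Measurable I) (hfin : ∀ᵐ ω ∂Pr, I ω < ∞) {s : ℝ} (hs : 0 ≤ s) :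
    ∫ ω, Real.exp (-(s * (I ω).toReal)) ∂Pr =
      (∫⁻ ω, expNeg (ENNReal.ofReal s * I ω) ∂Pr).toReal := by
  rw [← integral_toReal (f := fun ω => expNeg (ENNReal.ofReal s * I ω))
    (measurable_expNeg.comp (hI.const_mul _)).aemeasurable
    (Eventually.of_forall fun ω => (expNeg_ne_top _).lt_top)]
  refine integral_congr_ae (hfin.mono fun ω hω => ?_)
  simp only
  rw [expNeg_toReal (ENNReal.mul_ne_top ENNReal.ofReal_ne_top hω.ne), ENNReal.toReal_mul,
    ENNReal.toReal_ofReal hs]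

namespace Network.IsModel

variable {Ω : Type*} [MeasurableSpace Ω] {Pr : Measure Ω} [IsProbabilityMeasure Pr]
  {p : Parameters} {N : Network Ω}

lemma coverage2_eq (hN : N.IsModel p Pr) {ζ s : ℝ} (hζ : 0 < ζ)
    (hs : s = ζ * (1 + p.d ^ p.α) / N.P2 p Pr) :
    N.coverage2 p Pr ζ = N.laplaceI1 p Pr s * N.laplaceI2 p Pr s *
      Real.exp (-(p.σ ^ 2 * s)) := by
  have hP := hN.P2_pos
  have hl : 0 < p.pathLoss p.d := p.pathLoss_pos p.d_nonneg
  have hs0 : 0 < s := by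
    have := Real.rpow_nonneg p.d_nonneg p.α
    rw [hs]
    positivity
  have hζs : ζ = N.P2 p Pr * p.pathLoss p.d * s := by
    have := Real.rpow_nonneg p.d_nonneg p.α
    rw [hs, Parameters.pathLoss]
    field_simp
  have hσ := sq_nonneg p.σ
  have hPl : 0 < N.P2 p Pr * p.pathLoss p.d := mul_pos hP hl
  set z : Ω → ℝ≥0∞ := fun ω =>
    ENNReal.ofReal s * (N.I1 p ω + N.I2 p Pr ω + ENNReal.ofReal (p.σ ^ 2)) with hz
  have hzm : Measurable z :=
    ((hN.measurable_I1.add hN.measurable_I2).add_const _).const_mul _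
  have hevent : {ω | ENNReal.ofReal ζ ≤ N.SINR2 p Pr ω} =ᵐ[Pr]
      {ω | z ω ≤ ENNReal.ofReal (N.g0 ω)} := by
    -- Positivity of g₀ excludes 0/0, which is 0 in `ℝ≥0∞`, when noise and interference both vanish.
    filter_upwards [hN.ae_g0_pos] with ω hω
    refine propext ?_
    change ENNReal.ofReal ζ ≤ N.SINR2 p Pr ω ↔ z ω ≤ ENNReal.ofReal (N.g0 ω)
    have h1 : N.P2 p Pr * N.g0 ω * p.pathLoss p.d =
        N.P2 p Pr * p.pathLoss p.d * N.g0 ω := by ring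
    rw [SINR2, ENNReal.le_div_iff_mul_le
      (Or.inr (by rw [h1]; simpa using mul_pos hPl hω)) (Or.inr ENNReal.ofReal_ne_top), h1, hζs,
      ENNReal.ofReal_mul hPl.le, ENNReal.ofReal_mul hPl.le, mul_assoc,
      ENNReal.mul_le_mul_iff_right (by simpa using hPl) ENNReal.ofReal_ne_top]
  have hind : IndepFun z N.g0 Pr :=
    hN.indepFun_interference_g0.comp
      (φ := fun x => ENNReal.ofReal s * (x + ENNReal.ofReal (p.σ ^ 2)))
      ((measurable_id.add_const _).const_mul _) measurable_id
  have hsplit (ω) : expNeg (z ω) = expNeg (ENNReal.ofReal s * N.I1 p ω) *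
      expNeg (ENNReal.ofReal s * N.I2 p Pr ω) *
      expNeg (ENNReal.ofReal s * ENNReal.ofReal (p.σ ^ 2)) := by
    rw [hz]
    simp only [mul_add, expNeg_add]
  have hm : Measurable fun x => expNeg (ENNReal.ofReal s * x) :=
    measurable_expNeg.comp (measurable_id.const_mul _)
  have hind2 := hN.indepFun_I1_I2.comp hm hm
  have hprod := lintegral_mul_eq_lintegral_mul_lintegral_of_indepFun
    (hm.comp hN.measurable_I1) (hm.comp hN.measurable_I2) hind2
  rw [coverage2, measureReal_congr hevent, Measure.real,
    measure_le_ofReal_of_indepFun hzm hN.measurable_g0 hN.law_g0 hind]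
  simp_rw [hsplit]
  rw [lintegral_mul_const' _ _ (expNeg_ne_top _)]
  simp only [Pi.mul_apply, Function.comp_apply] at hprod
  rw [hprod, ENNReal.toReal_mul, ENNReal.toReal_mul, laplaceI1, laplaceI2,
    integral_exp_neg_mul_toReal hN.measurable_I1 hN.ae_I1_lt_top hs0.le,
    integral_exp_neg_mul_toReal hN.measurable_I2 hN.ae_I2_lt_top hs0.le,
    ← ENNReal.ofReal_mul hs0.le, expNeg_toReal ENNReal.ofReal_ne_top,
    ENNReal.toReal_ofReal (by positivity), mul_comm s]

lemma laplaceI1_eq (hN : N.IsModel p Pr) {s : ℝ} (hs : 0 < s) :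
    N.laplaceI1 p Pr s = p.laplaceForm p.lam1 p.P1 s := by
  rw [laplaceI1, integral_exp_neg_mul_toReal hN.measurable_I1 hN.ae_I1_lt_top hs.le,
    hN.lintegral_expNeg_I1 hs, p.laplaceForm_eq p.lam1_pos.le (mul_pos p.P1_pos hs)]

lemma laplaceI2_eq (hN : N.IsModel p Pr) {s : ℝ} (hs : 0 < s) :
    N.laplaceI2 p Pr s =
      p.laplaceForm (p.lam2 * N.transmitProb p Pr) (N.P2 p Pr) s := by
  rw [laplaceI2, integral_exp_neg_mul_toReal hN.measurable_I2 hN.ae_I2_lt_top hs.le,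
    hN.lintegral_expNeg_I2 hN.P2_pos hs, p.laplaceForm_eq
      (mul_nonneg p.lam2_pos.le hN.transmitProb_nonneg) (mul_pos hN.P2_pos hs)]

end Network.IsModel

end AdHoc

theorem mainTheorem2 {Ω : Type*} [MeasurableSpace Ω] (Pr : Measure Ω) [IsProbabilityMeasure Pr]
    (p : AdHoc.Parameters) (N : AdHoc.Network Ω) (hN : N.IsModel p Pr)
    (ζ s : ℝ) (hζ : 0 < ζ) (hs : s = ζ * (1 + p.d ^ p.α) / N.P2 p Pr) :
    0 < N.P2 p Pr ∧
    (∀ᵐ ω ∂Pr, N.I1 p ω < ∞ ∧ N.I2 p Pr ω < ∞) ∧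
    N.coverage2 p Pr ζ = N.laplaceI1 p Pr s * N.laplaceI2 p Pr s * Real.exp (-(p.σ ^ 2 * s)) ∧
    N.laplaceI1 p Pr s = p.laplaceForm p.lam1 p.P1 s ∧
    N.laplaceI2 p Pr s = p.laplaceForm (p.lam2 * N.transmitProb p Pr) (N.P2 p Pr) s := by
  have hP := hN.P2_pos
  have hs0 : 0 < s := by
    have := Real.rpow_nonneg p.d_nonneg p.α
    rw [hs]
    positivity
  exact ⟨hP, hN.ae_I1_lt_top.and hN.ae_I2_lt_top, hN.coverage2_eq hζ hs, hN.laplaceI1_eq hs0,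
    hN.laplaceI2_eq hs0⟩
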